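/- **Theorem.** Let $P\ge 2$, $\eta\in(0,1]$ and $K_0\in\mathbb N^*$. Let $X$ be a random variable with values in a measurable space $G$ and $Y=(Y^1,\dots,Y^P)$ a square integrable random vector in $\mathbb R^P$, on a probability space $(\Omega,\mathcal F,\mathbb P)$, and let $\phi:G\to\mathbb R$ be measurable with $\phi(X)$ square integrable. Put $E_X^p=\mathbb E[Y^p|X]$, $M_X^p=\max\{E_X^1,\dots,E_X^p\}$, $\sigma_p(X)=\sqrt{\mathrm{Var}(Y^p|X)}$, $\Sigma_P^{\gamma}(X)=\sum_{p=1}^P\sigma_p^{\gamma}(X)$, $$C_P(X)=2^\eta\,\Sigma_P^{1+\eta}(X)\sum_{p=2}^P\frac1{|E_X^p-M_X^{p-1}|^\eta},\qquad D^p_{2+\eta}(X)=\mathbb E\big[|Y^p-E_X^p|^{2+\eta}\,\big|\,X\big]\in[0,\infty],$$ and $I=\mathbb E[M_X^P\phi(X)]$. Assume: 1. $\mathbb P(M_X^{p-1}=E_X^p)=0$ for all $p\in\{2,\dots,P\}$; 2. $\mathbb E[\Sigma_P^2(X)\phi^2(X)]<\infty$ and $\mathbb E[C_P(X)|\phi(X)|]<\infty$;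 3. $\mathrm{Var}(M_X^P\phi(X))<\infty$; 4. $\mathbb E\Big[\dfrac{D^{q}_{2+\eta}(X)}{|E_X^p-M_X^{p-1}|^\eta}\phi^2(X)\Big]<\infty$ for all $p\in\{2,\dots,P\}$ and $q\in\{1,\dots,p\}$. For $\varepsilon\in(0,1)$ let $$L=\Big\lceil\tfrac{2}{1+\eta}\tfrac{|\log\varepsilon|}{\log 2}\Big\rceil,\quad J_0=2^{\lceil 2|\log\varepsilon|/\log2\rceil},\quad J_l=\big\lceil J_0\,2^{-(1+\eta/4)l}\big\rceil\ (1\le l\le L),\quad K_l=K_0 2^l\ (0\le l\le L).$$ For each level $l\in\{0,\dots,L\}$ let $(X_{l,j})_{1\le j\le J_l}$ be i.i.d. with the law of $X$ and, given $(X_{l,j})_{1\le j\le J_l}$, let the $Y_{l,j,k}$ ($1\le j\le J_l$, $1\le k\le K_l$) be independent, $Y_{l,j,k}$ having the conditional law of $Y$ given $X=X_{l,j}$; the levels are independent. With $$\widehat M_{l,j,K}=\max_{1\le p\le P}\frac1K\sum_{k=1}^{K}Y^p_{l,j,k},\qquad \widehat M'_{l,j,K_{l-1}}=\max_{1\le p\le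 P}\frac1{K_{l-1}}\sum_{k=K_{l-1}+1}^{K_l}Y^p_{l,j,k},$$ define the antithetic multilevel Monte Carlo estimator $$\widehat I=\frac1{J_0}\sum_{j=1}^{J_0}\widehat M_{0,j,K_0}\phi(X_{0,j})+\sum_{l=1}^L\frac1{J_l}\sum_{j=1}^{J_l}\Big(\widehat M_{l,j,K_l}-\frac{\widehat M_{l,j,K_{l-1}}+\widehat M'_{l,j,K_{l-1}}}{2}\Big)\phi(X_{l,j}).$$ Then, as $\varepsilon\to0^+$, $\widehat I-I$ is square integrable with $\mathbb E[(\widehat I-I)^2]=O(\varepsilon^2)$, where $J_0=O(\varepsilon^{-2})$ and the computational cost, measured by the number $\sum_{l=0}^L J_lK_l$ of simulated inner samples, is $O(\varepsilon^{-2})$. The constants in the $O$'s and the range of $\varepsilon$ do not depend on $\varepsilon$ or on the choice of the samples. -/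

import Mathlib

open MeasureTheory ProbabilityTheory
open scoped ENNReal

namespace AntitheticMLMC

noncomputable section

/-- `runMax v n` is the maximum of the first `n` coordinates `v 0, …, v (n - 1)` of `v`.
It is used only for `1 ≤ n ≤ P`, where the index set is finite and non-empty. -/
def runMax {P : ℕ} (v : Fin P → ℝ) (n : ℕ) : ℝ :=
  ⨆ i : {i : Fin P // i.val < n}, v i.1

section Model

variable {Ω G : Type*} [MeasurableSpace Ω] [MeasurableSpace G] {P : ℕ}

/-- The vector `(E[Y^1 | X], …, E[Y^P | X])`, with coordinates indexed by `Fin P`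
(so `Y^p` is the coordinate `p - 1`). -/
def condMean (μ : Measure Ω) (X : Ω → G) (Y : Ω → Fin P → ℝ) (ω : Ω) : Fin P → ℝ :=
  fun p => (μ[fun ω' => Y ω' p | MeasurableSpace.comap X inferInstance]) ω

/-- The running maximum `M_X^n = max {E[Y^1 | X], …, E[Y^n | X]}`. -/
def condMax (μ : Measure Ω) (X : Ω → G) (Y : Ω → Fin P → ℝ) (n : ℕ) (ω : Ω) : ℝ :=
  runMax (condMean μ X Y ω) n

/-- The conditional standard deviation `σ_p(X) = √Var(Y^p | X)`. -/
def condStd (μ : Measure Ω) (X : Ω → G) (Y : Ω → Fin P → ℝ) (p : Fin P) (ω : Ω) : ℝ :=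
  Real.sqrt ((Var[fun ω' => Y ω' p; μ | MeasurableSpace.comap X inferInstance]) ω)

/-- `Σ_P^γ(X) = ∑_{p = 1}^P σ_p(X)^γ`. -/
def condStdSum (μ : Measure Ω) (X : Ω → G) (Y : Ω → Fin P → ℝ) (γ : ℝ) (ω : Ω) : ℝ :=
  ∑ p : Fin P, condStd μ X Y p ω ^ γ

/-- The gap `|E_X^p - M_X^{p-1}|` for `p ≥ 2`. In the numbering by `Fin P`, the coordinates before
`p` are the first `p.val` ones. -/
def gap (μ : Measure Ω) (X : Ω → G) (Y : Ω → Fin P → ℝ) (p : Fin P) (ω : Ω) : ℝ :=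
  |condMean μ X Y ω p - condMax μ X Y p.val ω|

/-- `C_P(X) = 2^η Σ_P^{1+η}(X) ∑_{p = 2}^P 1 / |E_X^p - M_X^{p-1}|^η`. -/
def biasWeight (μ : Measure Ω) (X : Ω → G) (Y : Ω → Fin P → ℝ) (η : ℝ) (ω : Ω) : ℝ :=
  (2 : ℝ) ^ η * condStdSum μ X Y (1 + η) ω *
    ∑ p : Fin P with 0 < p.val, 1 / gap μ X Y p ω ^ η

/-- The conditional central moment `D_r^p(X) = E[|Y^p - E[Y^p | X]|^r | X]`, with values in
`[0, ∞]`. -/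
def condCentralMoment (μ : Measure Ω) (X : Ω → G) (Y : Ω → Fin P → ℝ) (r : ℝ) (p : Fin P) :
    Ω → ℝ≥0∞ :=
  condLExp (MeasurableSpace.comap X inferInstance) μ
    (fun ω => ENNReal.ofReal (|Y ω p - condMean μ X Y ω p| ^ r))

/-- The target `I = E[max {E[Y^1 | X], …, E[Y^P | X]} φ(X)]`. -/
def target (μ : Measure Ω) (X : Ω → G) (Y : Ω → Fin P → ℝ) (φ : G → ℝ) : ℝ :=
  ∫ ω, condMax μ X Y P ω * φ (X ω) ∂μ

end Model

section Sampling

variable {Ω' G : Type*} [MeasurableSpace Ω'] [MeasurableSpace G] {P : ℕ}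

/-- The random variables used by a multilevel estimator with levels `0, …, L`, with `J l` outer
samples `X l j` at level `l` and, for each of them, `K l` inner samples `Y l j k`. Only the indices
`l ≤ L`, `j < J l`, `k < K l` matter. Here `ρ` is the law of the outer variable and `κ` is the
conditional law of the inner variable given the outer one. -/
structure IsNestedSample (ρ : Measure G) (κ : Kernel G (Fin P → ℝ)) (L : ℕ) (J K : ℕ → ℕ)
    (ν : Measure Ω') (X : ℕ → ℕ → Ω' → G) (Y : ℕ → ℕ → ℕ → Ω' → Fin P → ℝ) : Prop where
  measurable_outer : ∀ l ≤ L, ∀ j < J l, Measurable (X l j)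
  measurable_inner : ∀ l ≤ L, ∀ j < J l, ∀ k < K l, Measurable (Y l j k)
  /-- The outer samples have law `ρ`. -/
  law_outer : ∀ l ≤ L, ∀ j < J l, ν.map (X l j) = ρ
  /-- The outer samples of one level are independent. -/
  indep_outer : ∀ l ≤ L, iIndepFun (fun (j : Fin (J l)) => X l j) ν
  /-- Given the outer samples of level `l`, the inner samples of that level are independent and
  `Y l j k` has law `κ (X l j)`. -/
  law_inner : ∀ l ≤ L, ∀ A : Set (Fin (J l) → G), MeasurableSet A →
    ∀ B : Fin (J l) → Fin (K l) → Set (Fin P → ℝ), (∀ j k, MeasurableSet (B j k)) →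
      ν {ω | (fun j : Fin (J l) => X l j ω) ∈ A ∧
          ∀ (j : Fin (J l)) (k : Fin (K l)), Y l j k ω ∈ B j k} =
        ∫⁻ ω in {ω | (fun j : Fin (J l) => X l j ω) ∈ A},
          ∏ j : Fin (J l), ∏ k : Fin (K l), κ (X l j ω) (B j k) ∂ν
  /-- The levels are independent. -/
  indep_levels : iIndepFun
    (fun (l : Fin (L + 1)) (ω : Ω') =>
      ((fun j : Fin (J l) => X l j ω), (fun (j : Fin (J l)) (k : Fin (K l)) => Y l j k ω))) ν

/-- The empirical mean of the `n` vectors `y a, …, y (a + n - 1)`. -/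
def blockMean (y : ℕ → Fin P → ℝ) (a n : ℕ) : Fin P → ℝ :=
  fun p => (∑ k ∈ Finset.range n, y (a + k) p) / n

/-- The maximum over all coordinates of the empirical mean of `y a, …, y (a + n - 1)`. -/
def blockMax (y : ℕ → Fin P → ℝ) (a n : ℕ) : ℝ :=
  runMax (blockMean y a n) P

/-- The antithetic multilevel estimator. The second half-sample of level `l` consists of the inner
samples with (zero-based) indices `K (l - 1), …, 2 K (l - 1) - 1 = K l - 1`. -/
def antitheticEstimator (φ : G → ℝ) (L : ℕ) (J K : ℕ → ℕ)
    (X : ℕ → ℕ → Ω' → G) (Y : ℕ → ℕ → ℕ → Ω' → Fin P → ℝ) (ω : Ω') : ℝ :=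
  (1 / (J 0 : ℝ)) * ∑ j ∈ Finset.range (J 0),
      blockMax (fun k => Y 0 j k ω) 0 (K 0) * φ (X 0 j ω) +
  ∑ l ∈ Finset.Icc 1 L, (1 / (J l : ℝ)) * ∑ j ∈ Finset.range (J l),
      (blockMax (fun k => Y l j k ω) 0 (K l) -
        (blockMax (fun k => Y l j k ω) 0 (K (l - 1)) +
          blockMax (fun k => Y l j k ω) (K (l - 1)) (K (l - 1))) / 2) * φ (X l j ω)

end Sampling

/-- Number of inner samples per outer sample: `K_l = K_0 2^l`. -/
def innerCount (K₀ l : ℕ) : ℕ := K₀ * 2 ^ l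

/-- Number of levels: `L = ⌈(2 / (1 + η)) |log ε| / log 2⌉`. -/
def levelCount (η ε : ℝ) : ℕ := ⌈2 / (1 + η) * (|Real.log ε| / Real.log 2)⌉₊

/-- `J_0 = 2 ^ ⌈2 |log ε| / log 2⌉`. -/
def baseCount (ε : ℝ) : ℕ := 2 ^ ⌈2 * |Real.log ε| / Real.log 2⌉₊

/-- `J_l = ⌈J_0 2^{-(1 + η/4) l}⌉`, which for `l = 0` is `J_0`. -/
def outerCount (η ε : ℝ) (l : ℕ) : ℕ :=
  ⌈(baseCount ε : ℝ) * (2 : ℝ) ^ (-((1 + η / 4) * (l : ℝ)))⌉₊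

/-- The computational cost `∑_{l = 0}^L J_l K_l`: the number of inner samples that are drawn. -/
def cost (L : ℕ) (J K : ℕ → ℕ) : ℕ := ∑ l ∈ Finset.range (L + 1), J l * K l

end

end AntitheticMLMC

/-!
Fix a point `x` and let `a` be an index where the vector `m` of conditional means is maximal. For an
empirical mean `v`, the overshoot `max v - v a` is nonnegative, and a coordinate `q ≠ a` can attain
`max v` only if the deviations of `v` from `m` at `q` and `a` make up for `m a - m q`. With
`s = max a q`, this difference is at least the gap `|m s - max_{i < s} m i|`, and both `q` and `a`
are at most `s` (`exists_argmax_gap_le`). Hence the overshoot to the power `c` is at most the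
sum over `s` and `q ≤ s` of `(2 |v q - m q|) ^ (c + η) / gap_s ^ η` (`runMax_sub_rpow_le_gapSum`);
only the pairs `q ≤ s` occur in the assumption on the central moments of order `2 + η`.

With `c = 1` and the moments of order `1 + η ≤ 2` of a mean over `n` samples, this gives a bias of
order `n ^ (-(1 + η) / 2)` (`abs_integral_blockMax_sub_le`). Subtracting the coordinate `a`, which
is linear in `v`, turns the antithetic difference into a combination of three overshoots. With
`c = 2` and moments of order `2 + η ∈ [2, 3]`, its second moment is therefore of order
`n ^ (-(1 + η / 2))` (`lintegral_sq_antitheticDiff_le`); the required moment inequality for sums of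
independent centered variables is `integral_abs_sum_rpow_le`.

Both estimates are integrated against the law of an outer sample and its inner samples. That law is
realized on infinite sequences of inner samples (`pathLaw`), so that all levels share one space, and
`IsNestedSample.map_eq_pi` shows that a level consists of independent copies of it. The mean square
error is then the sum of the level variances, of which the one at level `l` is
`O(2 ^ (-(1 + η / 2) l) / J_l)`, and of the squared bias (`IsNestedSample.integral_sq_error_le`).
The exponent `1 + η / 4` in `J_l` lies strictly between the exponent `1` of the growth of `K_l` and
the exponent `1 + η / 2` of the decay of the variances, so cost and variance both reduce to
geometric series.
-/

namespace AntitheticMLMC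

/-! ### Running maxima and the overshoot of the empirical maximum -/

lemma le_runMax {P n : ℕ} (v : Fin P → ℝ) {i : Fin P} (hi : i.val < n) : v i ≤ runMax v n :=
  le_ciSup (f := fun j : {j : Fin P // j.val < n} => v j.1) (Set.finite_range _).bddAbove ⟨i, hi⟩

lemma exists_eq_runMax {P n : ℕ} (v : Fin P → ℝ) (hP : 0 < P) (hn : 0 < n) :
    ∃ i : Fin P, i.val < n ∧ v i = runMax v n := by
  have : Nonempty {j : Fin P // j.val < n} := ⟨⟨⟨0, hP⟩, hn⟩⟩
  obtain ⟨i, hi⟩ := exists_eq_ciSup_of_finite (f := fun j : {j : Fin P // j.val < n} => v j.1)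
  exact ⟨i.1, i.2, hi⟩

@[fun_prop]
lemma measurable_runMax {P : ℕ} (n : ℕ) : Measurable fun v : Fin P → ℝ => runMax v n := by
  unfold runMax
  exact Measurable.iSup fun i => measurable_pi_apply i.1

lemma abs_runMax_sub_runMax_le {P : ℕ} (hP : 0 < P) (v m : Fin P → ℝ) :
    |runMax v P - runMax m P| ≤ ∑ q, |v q - m q| := by
  obtain ⟨i, -, hi⟩ := exists_eq_runMax v hP hP
  obtain ⟨j, -, hj⟩ := exists_eq_runMax m hP hP
  have h1 := le_runMax v j.isLt
  have h2 := le_runMax m i.isLt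
  have h3 : ∀ q, |v q - m q| ≤ ∑ q, |v q - m q| := fun q =>
    Finset.single_le_sum (f := fun q => |v q - m q|) (fun _ _ => abs_nonneg _) (Finset.mem_univ q)
  have hi' := abs_le.1 (h3 i)
  have hj' := abs_le.1 (h3 j)
  rw [abs_le]
  constructor <;> linarith

/-- A coordinate `a` where `m` is maximal beats any other coordinate `q` by at least the gap at
`s = max a q`: if `q < a`, then `m q` is at most the running maximum before `a`; if `a < q`, then
the running maximum before `q` is `m a`. -/
lemma exists_argmax_gap_le {P : ℕ} (hP : 0 < P) (m : Fin P → ℝ) :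
    ∃ a, m a = runMax m P ∧ ∀ q, q ≠ a →
      ∃ s : Fin P, 0 < s.val ∧ q ≤ s ∧ a ≤ s ∧ |m s - runMax m s.val| ≤ m a - m q := by
  obtain ⟨a, -, ha⟩ := exists_eq_runMax m hP hP
  have hmax : ∀ i, m i ≤ m a := fun i => ha ▸ le_runMax m i.isLt
  refine ⟨a, ha, fun q hq => ?_⟩
  rcases lt_or_gt_of_ne hq with h | h
  · have ha0 : 0 < a.val := lt_of_le_of_lt (Nat.zero_le _) (Fin.lt_def.1 h)
    refine ⟨a, ha0, h.le, le_rfl, ?_⟩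
    obtain ⟨i, -, hi⟩ := exists_eq_runMax m hP ha0
    have h1 : m q ≤ runMax m a.val := le_runMax m (Fin.lt_def.1 h)
    rw [abs_of_nonneg (by rw [← hi]; linarith [hmax i])]
    linarith
  · have hq0 : 0 < q.val := lt_of_le_of_lt (Nat.zero_le _) (Fin.lt_def.1 h)
    refine ⟨q, hq0, le_rfl, h.le, ?_⟩
    obtain ⟨i, -, hi⟩ := exists_eq_runMax m hP hq0
    have h1 : m a ≤ runMax m q.val := le_runMax m (Fin.lt_def.1 h)
    have h2 : runMax m q.val = m a := le_antisymm (hi ▸ hmax i) h1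
    rw [h2, abs_sub_comm, abs_of_nonneg (by linarith [hmax q])]

/-- The weighted sum of powers of deviations of `v` from `m` that controls how far the maximum of
`v` exceeds the coordinate of `v` at an index where `m` is maximal. -/
noncomputable def gapSum {P : ℕ} (m v : Fin P → ℝ) (r η : ℝ) : ℝ :=
  ∑ s : Fin P with 0 < s.val, ∑ q ∈ Finset.Iic s,
    (2 * |v q - m q|) ^ r / |m s - runMax m s.val| ^ η

lemma gapSum_nonneg {P : ℕ} (m v : Fin P → ℝ) (r η : ℝ) : 0 ≤ gapSum m v r η :=
  Finset.sum_nonneg fun _ _ => Finset.sum_nonneg fun _ _ => by positivity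

/-- The overshoot `max v - v a`, where `a` is a maximal coordinate of `m` and `q` one of `v`, is at
most `t = 2 max (|v q - m q|, |v a - m a|)`, and it vanishes unless `t` exceeds the gap `δ` between
`m a` and `m q`. Hence its power `c` is at most `t ^ c (t / δ) ^ η`. -/
lemma runMax_sub_rpow_le_gapSum {P : ℕ} (hP : 0 < P) {m : Fin P → ℝ} {a : Fin P}
    (ha : ∀ q, q ≠ a →
      ∃ s : Fin P, 0 < s.val ∧ q ≤ s ∧ a ≤ s ∧ |m s - runMax m s.val| ≤ m a - m q)
    (hgap : ∀ s : Fin P, 0 < s.val → runMax m s.val ≠ m s)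
    {c η : ℝ} (hc : 0 < c) (hη : 0 ≤ η) (v : Fin P → ℝ) :
    (runMax v P - v a) ^ c ≤ gapSum m v (c + η) η := by
  obtain ⟨q, -, hq⟩ := exists_eq_runMax v hP hP
  by_cases hqa : q = a
  · rw [← hq, hqa, sub_self, Real.zero_rpow hc.ne']
    exact gapSum_nonneg _ _ _ _
  obtain ⟨s, hs0, hqs, has, hs⟩ := ha q hqa
  have hδ : 0 < |m s - runMax m s.val| := abs_pos.2 (sub_ne_zero.2 (hgap s hs0).symm)
  obtain ⟨b, hb, hbq, hba⟩ : ∃ b, b ≤ s ∧ |v q - m q| ≤ |v b - m b| ∧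
      |v a - m a| ≤ |v b - m b| := by
    rcases le_total |v q - m q| |v a - m a| with h | h
    · exact ⟨a, has, h, le_rfl⟩
    · exact ⟨q, hqs, le_rfl, h⟩
  have hnn : 0 ≤ runMax v P - v a := sub_nonneg.2 (le_runMax v a.isLt)
  have h1 := le_abs_self (v q - m q)
  have h2 := neg_abs_le (v a - m a)
  have hle : runMax v P - v a ≤ 2 * |v b - m b| := by rw [← hq]; linarith
  have hge : |m s - runMax m s.val| ≤ 2 * |v b - m b| := by
    rw [← hq] at hnn; linarith
  have hb0 : 0 < 2 * |v b - m b| := hδ.trans_le hge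
  calc (runMax v P - v a) ^ c ≤ (2 * |v b - m b|) ^ c := Real.rpow_le_rpow hnn hle hc.le
    _ ≤ (2 * |v b - m b|) ^ (c + η) / |m s - runMax m s.val| ^ η := by
        rw [le_div_iff₀ (Real.rpow_pos_of_pos hδ _), Real.rpow_add hb0]
        gcongr
    _ ≤ ∑ q ∈ Finset.Iic s, (2 * |v q - m q|) ^ (c + η) / |m s - runMax m s.val| ^ η :=
        Finset.single_le_sum
          (f := fun q => (2 * |v q - m q|) ^ (c + η) / |m s - runMax m s.val| ^ η)
          (fun _ _ => by positivity) (Finset.mem_Iic.2 hb)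
    _ ≤ gapSum m v (c + η) η :=
        Finset.single_le_sum (f := fun s : Fin P => ∑ q ∈ Finset.Iic s,
            (2 * |v q - m q|) ^ (c + η) / |m s - runMax m s.val| ^ η)
          (fun _ _ => Finset.sum_nonneg fun _ _ => by positivity)
          (Finset.mem_filter.2 ⟨Finset.mem_univ s, hs0⟩)

/-! ### Block means -/

lemma blockMean_two_mul {P : ℕ} (y : ℕ → Fin P → ℝ) (n : ℕ) (p : Fin P) :
    blockMean y 0 (2 * n) p = (blockMean y 0 n p + blockMean y n n p) / 2 := by
  simp only [blockMean, two_mul, Finset.sum_range_add, zero_add]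
  rcases eq_or_ne n 0 with rfl | hn
  · simp
  · push_cast
    field_simp
    ring

lemma blockMax_congr {P : ℕ} {y z : ℕ → Fin P → ℝ} {a n : ℕ}
    (h : ∀ k, k < a + n → y k = z k) : blockMax y a n = blockMax z a n := by
  unfold blockMax
  congr 1
  funext p
  unfold blockMean
  congr 1
  refine Finset.sum_congr rfl fun k hk => ?_
  rw [h (a + k) (by simpa using hk)]

@[fun_prop]
lemma measurable_blockMean {P : ℕ} (a n : ℕ) :
    Measurable fun y : ℕ → Fin P → ℝ => blockMean y a n := by
  unfold blockMean
  fun_prop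

@[fun_prop]
lemma measurable_blockMax {P : ℕ} (a n : ℕ) :
    Measurable fun y : ℕ → Fin P → ℝ => blockMax y a n :=
  (measurable_runMax P).comp (measurable_blockMean a n)

/-- The difference between the maximum of the mean over `2 n` samples and the average of the maxima
of the means over the two halves. -/
noncomputable def antitheticDiff {P : ℕ} (n : ℕ) (y : ℕ → Fin P → ℝ) : ℝ :=
  blockMax y 0 (2 * n) - (blockMax y 0 n + blockMax y n n) / 2

@[fun_prop]
lemma measurable_antitheticDiff {P : ℕ} (n : ℕ) :
    Measurable fun y : ℕ → Fin P → ℝ => antitheticDiff n y := by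
  unfold antitheticDiff
  fun_prop

/-- Each coordinate of the antithetic difference of means vanishes, so subtracting a fixed
coordinate `a` replaces the three maxima by three nonnegative overshoots. -/
lemma sq_antitheticDiff_le {P : ℕ} (n : ℕ) (y : ℕ → Fin P → ℝ) (a : Fin P) :
    antitheticDiff n y ^ 2 ≤ (blockMax y 0 (2 * n) - blockMean y 0 (2 * n) a) ^ 2 +
      (blockMax y 0 n - blockMean y 0 n a) ^ 2 + (blockMax y n n - blockMean y n n a) ^ 2 := by
  have h0 : 0 ≤ blockMax y 0 (2 * n) - blockMean y 0 (2 * n) a :=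
    sub_nonneg.2 (le_runMax _ a.isLt)
  have h1 : 0 ≤ blockMax y 0 n - blockMean y 0 n a := sub_nonneg.2 (le_runMax _ a.isLt)
  have h2 : 0 ≤ blockMax y n n - blockMean y n n a := sub_nonneg.2 (le_runMax _ a.isLt)
  have h3 := blockMean_two_mul y n a
  have h4 : antitheticDiff n y = (blockMax y 0 (2 * n) - blockMean y 0 (2 * n) a) -
      ((blockMax y 0 n - blockMean y 0 n a) + (blockMax y n n - blockMean y n n a)) / 2 := by
    rw [antitheticDiff, h3]; ring
  rw [h4]
  set u := blockMax y 0 (2 * n) - blockMean y 0 (2 * n) a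
  set v := blockMax y 0 n - blockMean y 0 n a
  set w := blockMax y n n - blockMean y n n a
  nlinarith [mul_nonneg h0 h1, mul_nonneg h0 h2, sq_nonneg (v - w)]

/-! ### Moments of sums of independent centered random variables -/

section Moments

variable {Ω : Type*} [MeasurableSpace Ω] {μ : Measure Ω}

/-- Second-order expansion of `|a + b| ^ r` for `2 ≤ r ≤ 3`. For `a = 1` and `|b| ≤ 1` it is
`(1 + b) ^ 2` times Bernoulli's inequality for the power `r - 2`. -/
lemma abs_add_rpow_le {r : ℝ} (h2 : 2 ≤ r) (h3 : r ≤ 3) (a b : ℝ) :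
    |a + b| ^ r ≤ |a| ^ r + r * (|a| ^ (r - 2) * a * b) +
      11 * (|a| ^ (r - 2) * b ^ 2 + |b| ^ r) := by
  have hr : r ≠ 0 := by linarith
  rcases eq_or_ne a 0 with rfl | ha
  · have h := Real.rpow_nonneg (abs_nonneg b) r
    have h' := mul_nonneg (Real.rpow_nonneg (abs_nonneg (0 : ℝ)) (r - 2)) (sq_nonneg b)
    simp only [zero_add, mul_zero, zero_mul, abs_zero, Real.zero_rpow hr] at h' ⊢
    linarith
  have key : ∀ t : ℝ, |1 + t| ^ r ≤ 1 + r * t + 11 * (t ^ 2 + |t| ^ r) := by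
    intro t
    rcases le_total |t| 1 with ht | ht
    · obtain ⟨ht1, ht2⟩ := abs_le.1 ht
      have h0 : 0 ≤ 1 + t := by linarith
      have hb := rpow_one_add_le_one_add_mul_self ht1 (p := r - 2) (by linarith) (by linarith)
      have hsplit : |1 + t| ^ r = (1 + t) ^ 2 * (1 + t) ^ (r - 2) := by
        rw [abs_of_nonneg h0, ← Real.rpow_two, ← Real.rpow_add_of_nonneg h0 (by norm_num)
          (by linarith)]
        congr 1; ring
      have hmul : (1 + t) ^ 2 * (1 + t) ^ (r - 2) ≤ (1 + t) ^ 2 * (1 + (r - 2) * t) :=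
        mul_le_mul_of_nonneg_left hb (sq_nonneg _)
      have ht3 : (r - 2) * t * t ^ 2 ≤ 1 * t ^ 2 :=
        mul_le_mul_of_nonneg_right (by nlinarith) (sq_nonneg t)
      have hrt : (r - 2) * t ^ 2 ≤ 1 * t ^ 2 :=
        mul_le_mul_of_nonneg_right (by linarith) (sq_nonneg t)
      have := Real.rpow_nonneg (abs_nonneg t) r
      rw [hsplit]
      nlinarith [sq_nonneg t]
    · have h1 : |1 + t| ≤ 2 * |t| := (abs_add_le 1 t).trans (by rw [abs_one]; linarith)
      have h2r : (2 : ℝ) ^ r ≤ 8 := by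
        calc (2 : ℝ) ^ r ≤ 2 ^ (3 : ℝ) := Real.rpow_le_rpow_of_exponent_le (by norm_num) h3
          _ = 8 := by norm_num
      have h4 : |1 + t| ^ r ≤ 8 * |t| ^ r := by
        calc |1 + t| ^ r ≤ (2 * |t|) ^ r := Real.rpow_le_rpow (abs_nonneg _) h1 (by linarith)
          _ = 2 ^ r * |t| ^ r := Real.mul_rpow (by norm_num) (abs_nonneg t)
          _ ≤ 8 * |t| ^ r := by gcongr
      have h5 : |t| ≤ |t| ^ r := by
        simpa using Real.rpow_le_rpow_of_exponent_le ht (by linarith : (1 : ℝ) ≤ r)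
      have h6 : -(3 * |t| ^ r) ≤ r * t := by
        have h7 : r * |t| ≤ 3 * |t| ^ r := mul_le_mul h3 h5 (abs_nonneg _) (by norm_num)
        have h8 := neg_abs_le t
        nlinarith
      nlinarith [sq_nonneg t]
  have hpos : 0 < |a| := abs_pos.2 ha
  have hk := mul_le_mul_of_nonneg_left (key (b / a)) (Real.rpow_nonneg hpos.le r)
  have e1 : |a| ^ r * |1 + b / a| ^ r = |a + b| ^ r := by
    rw [← Real.mul_rpow hpos.le (abs_nonneg _), ← abs_mul, mul_add, mul_div_cancel₀ b ha, mul_one]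
  have e2 : |a| ^ r = |a| ^ (r - 2) * a ^ 2 := by
    rw [← sq_abs a, ← Real.rpow_two, ← Real.rpow_add hpos]; congr 1; ring
  have e3 : |a| ^ r * |b / a| ^ r = |b| ^ r := by
    rw [← Real.mul_rpow hpos.le (abs_nonneg _), ← abs_mul, mul_div_cancel₀ b ha]
  have e4 : |a| ^ r * (b / a) = |a| ^ (r - 2) * a * b := by
    rw [e2]; field_simp
  have e5 : |a| ^ r * (b / a) ^ 2 = |a| ^ (r - 2) * b ^ 2 := by
    rw [e2]; field_simp
  rw [e1] at hk
  calc |a + b| ^ r ≤ |a| ^ r * (1 + r * (b / a) + 11 * ((b / a) ^ 2 + |b / a| ^ r)) := hk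
    _ = |a| ^ r + r * (|a| ^ r * (b / a)) +
        11 * (|a| ^ r * (b / a) ^ 2 + |a| ^ r * |b / a| ^ r) := by ring
    _ = _ := by rw [e3, e4, e5]

lemma integrable_abs_rpow [IsFiniteMeasure μ] {f : Ω → ℝ} {p r : ℝ}
    (hf : MemLp f (ENNReal.ofReal r) μ) (hp : 0 ≤ p) (hpr : p ≤ r) :
    Integrable (fun ω => |f ω| ^ p) μ := by
  have h := (hf.mono_exponent (ENNReal.ofReal_le_ofReal hpr)).integrable_norm_rpow'
  simpa [ENNReal.toReal_ofReal hp] using h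

/-- Jensen's inequality for the concave function `x ↦ x ^ θ`. -/
lemma integral_rpow_le_rpow_integral [IsProbabilityMeasure μ] {f : Ω → ℝ} {θ : ℝ}
    (h0 : 0 ≤ θ) (h1 : θ ≤ 1) (hf : ∀ ω, 0 ≤ f ω) (hfi : Integrable f μ) :
    ∫ ω, f ω ^ θ ∂μ ≤ (∫ ω, f ω ∂μ) ^ θ := by
  have hi : Integrable (fun ω => f ω ^ θ) μ := by
    have := integrable_abs_rpow (r := 1) (by simpa [memLp_one_iff_integrable] using hfi) h0 h1
    simpa only [abs_of_nonneg (hf _)] using this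
  exact (Real.concaveOn_rpow h0 h1).le_map_integral
    (continuousOn_id.rpow_const fun _ _ => Or.inr h0) isClosed_Ici
    (Filter.Eventually.of_forall hf) hfi hi

/-- A Marcinkiewicz–Zygmund type inequality: the moment of order `r ∈ [2, 3]` of a sum of `n`
independent centered variables is of order `n ^ (r / 2)`. One summand `b` at a time is added to
the partial sum `S`; in the expansion of `|S + b| ^ r` the linear term has mean zero, and Jensen's
inequality bounds the remainder, as `E[S ^ 2]` is at most `n D ^ (2 / r)`. -/
lemma integral_abs_sum_rpow_le [IsProbabilityMeasure μ] {ι : Type*} {ξ : ι → Ω → ℝ} {r D : ℝ}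
    (h2 : 2 ≤ r) (h3 : r ≤ 3) (hm : ∀ i, Measurable (ξ i)) (hind : iIndepFun ξ μ)
    (hL : ∀ i, MemLp (ξ i) (ENNReal.ofReal r) μ) (h0 : ∀ i, ∫ ω, ξ i ω ∂μ = 0)
    (hD : ∀ i, ∫ ω, |ξ i ω| ^ r ∂μ ≤ D) (s : Finset ι) :
    ∫ ω, |∑ i ∈ s, ξ i ω| ^ r ∂μ ≤ 22 * (s.card : ℝ) ^ (r / 2) * D := by
  classical
  have hr0 : 0 < r := by linarith
  have hL2 : ∀ i, MemLp (ξ i) 2 μ := fun i => (hL i).mono_exponent (by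
    rw [← ENNReal.ofReal_ofNat 2]; exact ENNReal.ofReal_le_ofReal h2)
  have hLS : ∀ t : Finset ι, MemLp (fun ω => ∑ i ∈ t, ξ i ω) (ENNReal.ofReal r) μ := fun t =>
    memLp_finsetSum t fun i _ => hL i
  rcases s.eq_empty_or_nonempty with rfl | hs
  · have : r / 2 ≠ 0 := by positivity
    simp [Real.zero_rpow hr0.ne', Real.zero_rpow this]
  have hD0 : 0 ≤ D := by
    obtain ⟨i, -⟩ := hs
    exact (integral_nonneg fun ω => Real.rpow_nonneg (abs_nonneg _) _).trans (hD i)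
  set N : ℝ := (s.card : ℝ) with hN
  have hN1 : 1 ≤ N := by rw [hN]; exact_mod_cast hs.card_pos
  set V : ℝ := D ^ (2 / r)
  have hV0 : 0 ≤ V := by positivity
  have hsq : ∀ i, ∫ ω, ξ i ω ^ 2 ∂μ ≤ V := by
    intro i
    have h := integral_rpow_le_rpow_integral (μ := μ) (f := fun ω => |ξ i ω| ^ r) (θ := 2 / r)
      (by positivity) (by rw [div_le_one hr0]; exact h2)
      (fun ω => Real.rpow_nonneg (abs_nonneg _) _)
      (integrable_abs_rpow (hL i) hr0.le le_rfl)
    have he : ∀ ω, (|ξ i ω| ^ r) ^ (2 / r) = ξ i ω ^ 2 := fun ω => by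
      rw [← Real.rpow_mul (abs_nonneg _), mul_div_cancel₀ _ hr0.ne', Real.rpow_two, sq_abs]
    simp only [he] at h
    exact h.trans (Real.rpow_le_rpow (integral_nonneg fun ω => Real.rpow_nonneg (abs_nonneg _) _)
      (hD i) (by positivity))
  have hVD : V ^ ((r - 2) / 2) * V = D := by
    rcases eq_or_lt_of_le hD0 with h | h
    · simp [V, ← h, Real.zero_rpow (show 2 / r ≠ 0 by positivity)]
    · have hVp : 0 < V := Real.rpow_pos_of_pos h _
      nth_rewrite 2 [← Real.rpow_one V]
      rw [← Real.rpow_add hVp, ← Real.rpow_mul hD0]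
      rw [show 2 / r * ((r - 2) / 2 + 1) = 1 by field_simp; ring, Real.rpow_one]
  have hsumsq : ∀ t ⊆ s, ∫ ω, (∑ i ∈ t, ξ i ω) ^ 2 ∂μ ≤ N * V := by
    intro t hts
    have hvar := IndepFun.variance_sum (μ := μ) (X := ξ) (s := t) (fun i _ => hL2 i)
      (fun i _ j _ hij => hind.indepFun hij)
    have hmean : ∫ ω, (∑ i ∈ t, ξ i) ω ∂μ = 0 := by
      simp only [Finset.sum_apply]
      rw [integral_finsetSum _ fun i _ => (hL2 i).integrable one_le_two]
      simp [h0]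
    rw [variance_of_integral_eq_zero (Finset.aemeasurable_sum _ fun i _ => (hm i).aemeasurable)
      hmean] at hvar
    simp only [Finset.sum_apply] at hvar
    rw [hvar]
    calc ∑ i ∈ t, Var[ξ i; μ] ≤ ∑ _i ∈ t, V := Finset.sum_le_sum fun i _ => by
          rw [variance_of_integral_eq_zero (hm i).aemeasurable (h0 i)]; exact hsq i
      _ = t.card * V := by simp
      _ ≤ N * V := by
          gcongr
          rw [hN]; exact_mod_cast Finset.card_le_card hts
  have hlow : ∀ t ⊆ s, ∫ ω, |∑ i ∈ t, ξ i ω| ^ (r - 2) ∂μ ≤ (N * V) ^ ((r - 2) / 2) := by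
    intro t hts
    have h := integral_rpow_le_rpow_integral (μ := μ) (f := fun ω => (∑ i ∈ t, ξ i ω) ^ 2)
      (θ := (r - 2) / 2) (by linarith) (by linarith) (fun ω => sq_nonneg _)
      (memLp_finsetSum t fun i _ => hL2 i).integrable_sq
    have he : ∀ ω, ((∑ i ∈ t, ξ i ω) ^ 2) ^ ((r - 2) / 2) = |∑ i ∈ t, ξ i ω| ^ (r - 2) :=
      fun ω => by
        rw [← sq_abs, ← Real.rpow_two, ← Real.rpow_mul (abs_nonneg _)]; congr 1; ring
    simp only [he] at h
    exact h.trans (Real.rpow_le_rpow (integral_nonneg fun ω => sq_nonneg _) (hsumsq t hts)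
      (by linarith))
  have hind' : ∀ t ⊆ s, ∫ ω, |∑ i ∈ t, ξ i ω| ^ r ∂μ ≤
      22 * (t.card : ℝ) * N ^ ((r - 2) / 2) * D := by
    intro t
    induction t using Finset.induction_on with
    | empty => intro _; simp [Real.zero_rpow hr0.ne']
    | insert i t hit ih =>
      intro hts
      have hts' : t ⊆ s := (Finset.subset_insert i t).trans hts
      have hS := hLS t
      set S : Ω → ℝ := fun ω => ∑ i ∈ t, ξ i ω with hSdef
      have hSm : Measurable S := Finset.measurable_sum t fun i _ => hm i
      have hSi : IndepFun S (ξ i) μ := by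
        have h := hind.indepFun_finsetSum_of_notMem hm hit
        convert h using 1
        ext ω
        simp [hSdef]
      have i1 : Integrable (fun ω => |S ω| ^ r) μ := integrable_abs_rpow hS hr0.le le_rfl
      have i2 : Integrable (fun ω => |ξ i ω| ^ r) μ := integrable_abs_rpow (hL i) hr0.le le_rfl
      have i3 : Integrable (fun ω => |S ω| ^ (r - 2) * S ω) μ := by
        refine (integrable_abs_rpow (p := r - 1) hS (by linarith) (by linarith)).mono'
          (by fun_prop) (Filter.Eventually.of_forall fun ω => ?_)
        rw [Real.norm_eq_abs, abs_mul, abs_of_nonneg (Real.rpow_nonneg (abs_nonneg _) _)]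
        rcases eq_or_lt_of_le (abs_nonneg (S ω)) with h | h
        · rw [← h, mul_zero]; exact Real.rpow_nonneg le_rfl _
        · nth_rewrite 2 [← Real.rpow_one |S ω|]
          rw [← Real.rpow_add h]
          exact (congrArg _ (by ring)).le
      have i4 : Integrable (fun ω => |S ω| ^ (r - 2)) μ :=
        integrable_abs_rpow hS (by linarith) (by linarith)
      have i5 : Integrable (fun ω => ξ i ω) μ := (hL2 i).integrable one_le_two
      have i6 : Integrable (fun ω => ξ i ω ^ 2) μ := (hL2 i).integrable_sq
      have ind1 : IndepFun (fun ω => |S ω| ^ (r - 2) * S ω) (fun ω => ξ i ω) μ :=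
        hSi.comp (φ := fun x => |x| ^ (r - 2) * x) (ψ := fun x => x) (by fun_prop) (by fun_prop)
      have ind2 : IndepFun (fun ω => |S ω| ^ (r - 2)) (fun ω => ξ i ω ^ 2) μ :=
        hSi.comp (φ := fun x => |x| ^ (r - 2)) (ψ := fun x => x ^ 2) (by fun_prop) (by fun_prop)
      have j1 : Integrable (fun ω => |S ω| ^ (r - 2) * S ω * ξ i ω) μ := ind1.integrable_mul i3 i5
      have j2 : Integrable (fun ω => |S ω| ^ (r - 2) * ξ i ω ^ 2) μ := ind2.integrable_mul i4 i6
      have k1 : ∫ ω, |S ω| ^ (r - 2) * S ω * ξ i ω ∂μ = 0 := by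
        rw [ind1.integral_fun_mul_eq_mul_integral i3.1 i5.1, h0, mul_zero]
      have k2 : ∫ ω, |S ω| ^ (r - 2) * ξ i ω ^ 2 ∂μ ≤ N ^ ((r - 2) / 2) * D := by
        rw [ind2.integral_fun_mul_eq_mul_integral i4.1 i6.1]
        calc (∫ ω, |S ω| ^ (r - 2) ∂μ) * ∫ ω, ξ i ω ^ 2 ∂μ
            ≤ (N * V) ^ ((r - 2) / 2) * V :=
              mul_le_mul (hlow t hts') (hsq i) (integral_nonneg fun ω => sq_nonneg _)
                (by positivity)
          _ = N ^ ((r - 2) / 2) * D := by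
              rw [Real.mul_rpow (by linarith) hV0, mul_assoc, hVD]
      have hN2 : 1 ≤ N ^ ((r - 2) / 2) := Real.one_le_rpow hN1 (by linarith)
      have hins : ∀ ω, ∑ j ∈ insert i t, ξ j ω = S ω + ξ i ω := fun ω => by
        rw [Finset.sum_insert hit, add_comm]
      simp only [hins]
      have j3 : Integrable (fun ω => |S ω| ^ r + r * (|S ω| ^ (r - 2) * S ω * ξ i ω)) μ :=
        i1.add (j1.const_mul r)
      have j4 : Integrable (fun ω => 11 * (|S ω| ^ (r - 2) * ξ i ω ^ 2 + |ξ i ω| ^ r)) μ :=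
        (j2.add i2).const_mul 11
      have hstep : ∫ ω, |S ω + ξ i ω| ^ r ∂μ ≤
          ∫ ω, (|S ω| ^ r + r * (|S ω| ^ (r - 2) * S ω * ξ i ω) +
            11 * (|S ω| ^ (r - 2) * ξ i ω ^ 2 + |ξ i ω| ^ r)) ∂μ :=
        integral_mono (integrable_abs_rpow (hS.add (hL i)) hr0.le le_rfl)
          (j3.add j4) fun ω => abs_add_rpow_le h2 h3 _ _
      rw [integral_add j3 j4, integral_add i1 (j1.const_mul r), integral_const_mul,
        integral_const_mul,
        integral_add j2 i2, k1] at hstep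
      have hD' : D ≤ N ^ ((r - 2) / 2) * D := le_mul_of_one_le_left hD0 hN2
      have := ih hts'
      have := hD i
      rw [Finset.card_insert_of_notMem hit]
      push_cast
      linarith
  refine (hind' s subset_rfl).trans (le_of_eq ?_)
  rw [mul_assoc 22 _ (N ^ _), ← hN]
  congr 2
  nth_rewrite 1 [← Real.rpow_one N]
  rw [← Real.rpow_add (by linarith)]
  congr 1; ring

end Moments

/-! ### Empirical means of independent samples of a fixed law -/

section Blocks

variable {P : ℕ} {lam : Measure (Fin P → ℝ)}

/-- The mean vector of a law on `ℝ ^ P`. -/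
noncomputable def meanVec (lam : Measure (Fin P → ℝ)) : Fin P → ℝ := fun p => ∫ z, z p ∂lam

/-- The law of a sequence of independent samples of `lam`. -/
noncomputable abbrev iidLaw (lam : Measure (Fin P → ℝ)) : Measure (ℕ → Fin P → ℝ) :=
  Measure.infinitePi fun _ => lam

variable [IsProbabilityMeasure lam]

lemma measurePreserving_eval_iidLaw (k : ℕ) :
    MeasurePreserving (fun y : ℕ → Fin P → ℝ => y k) (iidLaw lam) lam :=
  measurePreserving_eval_infinitePi (fun _ : ℕ => lam) k

lemma iIndepFun_coord (q : Fin P) (m : ℝ) :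
    iIndepFun (fun (k : ℕ) (y : ℕ → Fin P → ℝ) => y k q - m) (iidLaw lam) :=
  iIndepFun_infinitePi (P := fun _ : ℕ => lam) (X := fun _ z => z q - m) fun _ => by fun_prop

lemma blockMean_sub_eq {n : ℕ} (hn : 0 < n) (y : ℕ → Fin P → ℝ) (a : ℕ) (q : Fin P) (m : ℝ) :
    blockMean y a n q - m = (∑ k ∈ Finset.Ico a (a + n), (y k q - m)) / n := by
  have : (n : ℝ) ≠ 0 := by positivity
  rw [Finset.sum_Ico_eq_sum_range, add_tsub_cancel_left, Finset.sum_sub_distrib, blockMean]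
  simp
  field_simp

lemma memLp_coord_sub {q : Fin P} {r : ℝ≥0∞} (h : MemLp (fun z => z q) r lam) (k : ℕ) (m : ℝ) :
    MemLp (fun y : ℕ → Fin P → ℝ => y k q - m) r (iidLaw lam) :=
  (h.sub (memLp_const m)).comp_measurePreserving (measurePreserving_eval_iidLaw k)

lemma memLp_blockMean {q : Fin P} {r : ℝ≥0∞} (h : MemLp (fun z => z q) r lam) (a n : ℕ) :
    MemLp (fun y => blockMean y a n q) r (iidLaw lam) := by
  have h1 : MemLp (fun y : ℕ → Fin P → ℝ => ∑ k ∈ Finset.range n, (y (a + k) q - 0)) r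
      (iidLaw lam) := memLp_finsetSum _ fun k _ => memLp_coord_sub h (a + k) 0
  have h2 := h1.const_mul (n : ℝ)⁻¹
  refine h2.ae_eq (Filter.Eventually.of_forall fun y => ?_)
  simp [blockMean, div_eq_inv_mul]

lemma integral_comp_eval_iidLaw (f : (Fin P → ℝ) → ℝ) (hf : Measurable f) (k : ℕ) :
    ∫ y, f (y k) ∂(iidLaw lam) = ∫ z, f z ∂lam := by
  have h := integral_map (μ := iidLaw lam) (φ := fun y : ℕ → Fin P → ℝ => y k)
    (measurable_pi_apply k).aemeasurable (f := f) hf.aestronglyMeasurable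
  rw [(measurePreserving_eval_iidLaw (lam := lam) k).map_eq] at h
  exact h.symm

lemma integral_coord_sub {q : Fin P} (h : Integrable (fun z => z q) lam) (k : ℕ) :
    ∫ y, (y k q - meanVec lam q) ∂(iidLaw lam) = 0 := by
  rw [integral_comp_eval_iidLaw (fun z => z q - meanVec lam q) (by fun_prop) k,
    integral_sub h (integrable_const _)]
  simp [meanVec]

lemma integral_blockMean {q : Fin P} (h : Integrable (fun z => z q) lam) (a : ℕ) {n : ℕ}
    (hn : 0 < n) : ∫ y, blockMean y a n q ∂(iidLaw lam) = meanVec lam q := by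
  have hi : Integrable (fun y => blockMean y a n q) (iidLaw lam) :=
    memLp_one_iff_integrable.1 (memLp_blockMean (memLp_one_iff_integrable.2 h) a n)
  have h1 : ∫ y, (blockMean y a n q - meanVec lam q) ∂(iidLaw lam) = 0 := by
    simp only [blockMean_sub_eq hn]
    rw [integral_div, integral_finsetSum]
    · simp [integral_coord_sub h]
    · exact fun k _ => memLp_one_iff_integrable.1
        (memLp_coord_sub (memLp_one_iff_integrable.2 h) k _)
  rw [integral_sub hi (integrable_const _)] at h1
  simp at h1
  linarith

lemma integral_sq_blockMean_sub {q : Fin P} (h : MemLp (fun z => z q) 2 lam) (a : ℕ) {n : ℕ}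
    (hn : 0 < n) :
    ∫ y, (blockMean y a n q - meanVec lam q) ^ 2 ∂(iidLaw lam) = Var[fun z => z q; lam] / n := by
  have hm := integral_blockMean (h.integrable one_le_two) a hn
  have hvar := IndepFun.variance_sum (μ := iidLaw lam)
    (X := fun (k : ℕ) (y : ℕ → Fin P → ℝ) => y k q - meanVec lam q) (s := Finset.Ico a (a + n))
    (fun k _ => memLp_coord_sub h k _)
    (fun i _ j _ hij => (iIndepFun_coord q (meanVec lam q)).indepFun hij)
  have hmean : ∫ y, (∑ k ∈ Finset.Ico a (a + n), fun y : ℕ → Fin P → ℝ =>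
      y k q - meanVec lam q) y ∂(iidLaw lam) = 0 := by
    simp only [Finset.sum_apply]
    rw [integral_finsetSum]
    · simp [integral_coord_sub (h.integrable one_le_two)]
    · exact fun k _ => (memLp_coord_sub h k _).integrable one_le_two
  rw [variance_of_integral_eq_zero
    (Finset.aemeasurable_sum _ fun k _ => Measurable.aemeasurable (by fun_prop)) hmean] at hvar
  simp only [Finset.sum_apply] at hvar
  have hk : ∀ k : ℕ, Var[fun y : ℕ → Fin P → ℝ => y k q - meanVec lam q; iidLaw lam] =
      Var[fun z => z q; lam] := fun k => by
    rw [variance_of_integral_eq_zero (Measurable.aemeasurable (by fun_prop))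
        (integral_coord_sub (h.integrable one_le_two) k),
      integral_comp_eval_iidLaw (fun z => (z q - meanVec lam q) ^ 2) (by fun_prop) k,
      variance_eq_integral (measurable_pi_apply q).aemeasurable]
    rfl
  simp only [hk] at hvar
  simp only [blockMean_sub_eq hn, div_pow]
  rw [integral_div, hvar]
  simp
  field_simp

/-- Moments of order at most two, by Jensen's inequality. -/
lemma integral_abs_blockMean_sub_rpow_le {q : Fin P} (h : MemLp (fun z => z q) 2 lam) (a : ℕ)
    {n : ℕ} (hn : 0 < n) {c : ℝ} (h0 : 0 ≤ c) (h2 : c ≤ 2) :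
    ∫ y, |blockMean y a n q - meanVec lam q| ^ c ∂(iidLaw lam) ≤
      (n : ℝ) ^ (-(c / 2)) * √(Var[fun z => z q; lam]) ^ c := by
  have hJ := integral_rpow_le_rpow_integral (μ := iidLaw lam)
    (f := fun y => (blockMean y a n q - meanVec lam q) ^ 2) (θ := c / 2) (by linarith)
    (by linarith) (fun _ => sq_nonneg _)
    ((memLp_blockMean h a n).sub (memLp_const _)).integrable_sq
  have he : ∀ y, ((blockMean y a n q - meanVec lam q) ^ 2) ^ (c / 2) =
      |blockMean y a n q - meanVec lam q| ^ c := fun y => by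
    rw [← sq_abs, ← Real.rpow_two, ← Real.rpow_mul (abs_nonneg _)]; congr 1; ring
  simp only [he] at hJ
  refine hJ.trans (le_of_eq ?_)
  rw [integral_sq_blockMean_sub h a hn, Real.div_rpow (variance_nonneg _ _) (by positivity),
    Real.rpow_neg (by positivity), Real.sqrt_eq_rpow, ← Real.rpow_mul (variance_nonneg _ _),
    show 1 / 2 * c = c / 2 by ring, div_eq_inv_mul]

/-- Moments of order between two and three. The bound holds in `[0, ∞]`, where the moment of `lam`
may be infinite. -/
lemma lintegral_abs_blockMean_sub_rpow_le {q : Fin P} (h : MemLp (fun z => z q) 2 lam) (a : ℕ)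
    {n : ℕ} (hn : 0 < n) {r : ℝ} (h2 : 2 ≤ r) (h3 : r ≤ 3) :
    ∫⁻ y, ENNReal.ofReal (|blockMean y a n q - meanVec lam q| ^ r) ∂(iidLaw lam) ≤
      ENNReal.ofReal (22 * (n : ℝ) ^ (-(r / 2))) *
        ∫⁻ z, ENNReal.ofReal (|z q - meanVec lam q| ^ r) ∂lam := by
  have hr0 : 0 < r := by linarith
  have hn0 : (0 : ℝ) < n := by exact_mod_cast hn
  by_cases htop : ∫⁻ z, ENNReal.ofReal (|z q - meanVec lam q| ^ r) ∂lam = ∞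
  · rw [htop, ENNReal.mul_top]
    · exact le_top
    · simp; positivity
  have hfin : Integrable (fun z : Fin P → ℝ => |z q - meanVec lam q| ^ r) lam :=
    ⟨Measurable.aestronglyMeasurable (by fun_prop),
      (hasFiniteIntegral_iff_ofReal (Filter.Eventually.of_forall fun z =>
      Real.rpow_nonneg (abs_nonneg _) _)).2 (lt_top_iff_ne_top.2 htop)⟩
  have hrn : ENNReal.ofReal r ≠ 0 := by simpa using hr0
  have hL' : MemLp (fun z : Fin P → ℝ => z q - meanVec lam q) (ENNReal.ofReal r) lam := by
    rw [← integrable_norm_rpow_iff (Measurable.aestronglyMeasurable (by fun_prop)) hrn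
      ENNReal.ofReal_ne_top]
    simpa [ENNReal.toReal_ofReal hr0.le] using hfin
  have hL : MemLp (fun z : Fin P → ℝ => z q) (ENNReal.ofReal r) lam :=
    (hL'.add (memLp_const (meanVec lam q))).ae_eq (Filter.Eventually.of_forall fun z => by simp)
  have key := integral_abs_sum_rpow_le (μ := iidLaw lam)
    (ξ := fun (k : ℕ) (y : ℕ → Fin P → ℝ) => y k q - meanVec lam q) h2 h3
    (fun k => by fun_prop) (iIndepFun_coord q _) (fun k => memLp_coord_sub hL k _)
    (integral_coord_sub (h.integrable one_le_two))
    (fun k => (integral_comp_eval_iidLaw (fun z => |z q - meanVec lam q| ^ r) (by fun_prop) k).le)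
    (Finset.Ico a (a + n))
  have hreal : ∫ y, |blockMean y a n q - meanVec lam q| ^ r ∂(iidLaw lam) ≤
      22 * (n : ℝ) ^ (-(r / 2)) * ∫ z, |z q - meanVec lam q| ^ r ∂lam := by
    simp only [blockMean_sub_eq hn, abs_div, Nat.abs_cast]
    simp only [Real.div_rpow (abs_nonneg _) hn0.le]
    rw [integral_div, div_le_iff₀ (Real.rpow_pos_of_pos hn0 _)]
    refine key.trans (le_of_eq ?_)
    have hsplit : (n : ℝ) ^ (r / 2) = (n : ℝ) ^ (-(r / 2)) * (n : ℝ) ^ r := by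
      rw [← Real.rpow_add hn0]; congr 1; ring
    simp only [Nat.card_Ico, add_tsub_cancel_left]
    rw [hsplit]
    ring
  have hbi : Integrable (fun y => |blockMean y a n q - meanVec lam q| ^ r) (iidLaw lam) :=
    integrable_abs_rpow ((memLp_blockMean hL a n).sub (memLp_const _)) hr0.le le_rfl
  rw [← ofReal_integral_eq_lintegral_ofReal hbi (Filter.Eventually.of_forall fun _ =>
      Real.rpow_nonneg (abs_nonneg _) _),
    ← ofReal_integral_eq_lintegral_ofReal hfin (Filter.Eventually.of_forall fun _ =>
      Real.rpow_nonneg (abs_nonneg _) _), ← ENNReal.ofReal_mul (by positivity)]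
  exact ENNReal.ofReal_le_ofReal hreal

/-! ### Bias and antithetic variance for a fixed law -/

lemma memLp_blockMax (h : ∀ q, MemLp (fun z => z q) 2 lam) (hP : 0 < P) (a n : ℕ) :
    MemLp (fun y => blockMax y a n) 2 (iidLaw lam) := by
  have h1 : MemLp (fun y => ∑ q, |blockMean y a n q - meanVec lam q|) 2 (iidLaw lam) :=
    memLp_finsetSum _ fun q _ => ((memLp_blockMean (h q) a n).sub (memLp_const _)).norm
  have h2 : MemLp (fun y => blockMax y a n - runMax (meanVec lam) P) 2 (iidLaw lam) := by
    refine h1.of_le (by fun_prop) (Filter.Eventually.of_forall fun y => ?_)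
    exact (abs_runMax_sub_runMax_le hP _ _).trans (le_abs_self _)
  exact (h2.add (memLp_const (runMax (meanVec lam) P))).ae_eq
    (Filter.Eventually.of_forall fun y => by simp)

/-- The mean of the empirical maximum exceeds the maximum of the means by `O(n ^ (-(1 + η) / 2))`,
as the overshoot is dominated by moments of order `1 + η`. -/
lemma abs_integral_blockMax_sub_le (h : ∀ q, MemLp (fun z => z q) 2 lam) (hP : 0 < P)
    (hgap : ∀ s : Fin P, 0 < s.val → runMax (meanVec lam) s.val ≠ meanVec lam s)
    {η : ℝ} (hη : 0 < η) (hη' : η ≤ 1) {n : ℕ} (hn : 0 < n) :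
    |∫ y, blockMax y 0 n ∂(iidLaw lam) - runMax (meanVec lam) P| ≤
      2 * (n : ℝ) ^ (-((1 + η) / 2)) *
        (2 ^ η * (∑ q, √(Var[fun z => z q; lam]) ^ (1 + η)) *
          ∑ s : Fin P with 0 < s.val, 1 / |meanVec lam s - runMax (meanVec lam) s.val| ^ η) := by
  obtain ⟨a, ha, hmax⟩ := exists_argmax_gap_le hP (meanVec lam)
  have hM := (memLp_blockMax h hP 0 n).integrable one_le_two
  have hA := (memLp_blockMean (h a) 0 n).integrable one_le_two
  have heq : ∫ y, blockMax y 0 n ∂(iidLaw lam) - runMax (meanVec lam) P =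
      ∫ y, (blockMax y 0 n - blockMean y 0 n a) ∂(iidLaw lam) := by
    rw [integral_sub hM hA, integral_blockMean ((h a).integrable one_le_two) 0 hn, ha]
  have hnn : ∀ y, 0 ≤ blockMax y 0 n - blockMean y 0 n a := fun y =>
    sub_nonneg.2 (le_runMax _ a.isLt)
  have hterm : ∀ q, Integrable (fun y => |blockMean y 0 n q - meanVec lam q| ^ (1 + η))
      (iidLaw lam) := fun q =>
    integrable_abs_rpow (r := 2) (by
      rw [ENNReal.ofReal_ofNat]
      exact (memLp_blockMean (h q) 0 n).sub (memLp_const (meanVec lam q))) (by linarith)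
      (by linarith)
  have hterm' : ∀ (s q : Fin P), Integrable (fun y =>
      (2 * |blockMean y 0 n q - meanVec lam q|) ^ (1 + η) /
        |meanVec lam s - runMax (meanVec lam) s.val| ^ η) (iidLaw lam) := fun s q => by
    simp only [Real.mul_rpow (zero_le_two) (abs_nonneg _)]
    exact ((hterm q).const_mul _).div_const _
  rw [heq, abs_of_nonneg (integral_nonneg hnn)]
  calc ∫ y, (blockMax y 0 n - blockMean y 0 n a) ∂(iidLaw lam)
      ≤ ∫ y, gapSum (meanVec lam) (blockMean y 0 n) (1 + η) η ∂(iidLaw lam) := by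
        refine integral_mono (hM.sub hA) ?_ fun y => ?_
        · exact integrable_finsetSum _ fun s _ => integrable_finsetSum _ fun q _ => hterm' s q
        · have h1 := runMax_sub_rpow_le_gapSum hP hmax hgap one_pos hη.le (blockMean y 0 n)
          rwa [Real.rpow_one] at h1
    _ = ∑ s : Fin P with 0 < s.val, ∑ q ∈ Finset.Iic s,
          2 ^ (1 + η) * (∫ y, |blockMean y 0 n q - meanVec lam q| ^ (1 + η) ∂(iidLaw lam)) /
            |meanVec lam s - runMax (meanVec lam) s.val| ^ η := by
        unfold gapSum
        rw [integral_finsetSum _ fun s _ => integrable_finsetSum _ fun q _ => hterm' s q]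
        refine Finset.sum_congr rfl fun s _ => ?_
        rw [integral_finsetSum _ fun q _ => hterm' s q]
        refine Finset.sum_congr rfl fun q _ => ?_
        simp only [Real.mul_rpow (zero_le_two) (abs_nonneg _)]
        rw [integral_div, integral_const_mul]
    _ ≤ ∑ s : Fin P with 0 < s.val, ∑ q : Fin P,
          2 ^ (1 + η) * ((n : ℝ) ^ (-((1 + η) / 2)) * √(Var[fun z => z q; lam]) ^ (1 + η)) /
            |meanVec lam s - runMax (meanVec lam) s.val| ^ η := by
        refine Finset.sum_le_sum fun s _ => ?_
        refine (Finset.sum_le_sum fun q _ => ?_).trans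
          (Finset.sum_le_sum_of_subset_of_nonneg (Finset.subset_univ _) fun q _ _ => ?_)
        · gcongr
          exact integral_abs_blockMean_sub_rpow_le (h q) 0 hn (by linarith) (by linarith)
        · positivity
    _ = _ := by
        rw [Real.rpow_add zero_lt_two, Real.rpow_one, Finset.mul_sum, Finset.mul_sum]
        refine Finset.sum_congr rfl fun s _ => ?_
        rw [Finset.mul_sum, Finset.sum_mul, Finset.mul_sum]
        refine Finset.sum_congr rfl fun q _ => ?_
        ring

/-- The overshoot of the maximum of a block mean over its coordinate `a`, where the mean vector is
maximal, is dominated in square by moments of order `2 + η`. -/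
lemma lintegral_sq_overshoot_le (h : ∀ q, MemLp (fun z => z q) 2 lam) (hP : 0 < P)
    (hgap : ∀ s : Fin P, 0 < s.val → runMax (meanVec lam) s.val ≠ meanVec lam s)
    {η : ℝ} (hη : 0 < η) (hη' : η ≤ 1) {a : Fin P} (ha : ∀ q, q ≠ a →
      ∃ s : Fin P, 0 < s.val ∧ q ≤ s ∧ a ≤ s ∧
        |meanVec lam s - runMax (meanVec lam) s.val| ≤ meanVec lam a - meanVec lam q)
    (b : ℕ) {n : ℕ} (hn : 0 < n) :
    ∫⁻ y, ENNReal.ofReal ((blockMax y b n - blockMean y b n a) ^ 2) ∂(iidLaw lam) ≤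
      ENNReal.ofReal (176 * (n : ℝ) ^ (-((2 + η) / 2))) *
        ∑ s : Fin P with 0 < s.val, ∑ q ∈ Finset.Iic s,
          (∫⁻ z, ENNReal.ofReal (|z q - meanVec lam q| ^ (2 + η)) ∂lam) /
            ENNReal.ofReal (|meanVec lam s - runMax (meanVec lam) s.val| ^ η) := by
  have hδ : ∀ s : Fin P, 0 < s.val → 0 < |meanVec lam s - runMax (meanVec lam) s.val| ^ η :=
    fun s hs => Real.rpow_pos_of_pos (abs_pos.2 (sub_ne_zero.2 (hgap s hs).symm)) _
  have h8 : (2 : ℝ) ^ (2 + η) ≤ 8 := by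
    calc (2 : ℝ) ^ (2 + η) ≤ 2 ^ (3 : ℝ) :=
          Real.rpow_le_rpow_of_exponent_le (by norm_num) (by linarith)
      _ = 8 := by norm_num
  have hpt : ∀ y, ENNReal.ofReal ((blockMax y b n - blockMean y b n a) ^ 2) ≤
      ∑ s : Fin P with 0 < s.val, ∑ q ∈ Finset.Iic s,
        ENNReal.ofReal 8 *
          ENNReal.ofReal (|blockMean y b n q - meanVec lam q| ^ (2 + η)) *
            (ENNReal.ofReal (|meanVec lam s - runMax (meanVec lam) s.val| ^ η))⁻¹ := by
    intro y
    have h1 := runMax_sub_rpow_le_gapSum hP ha hgap two_pos hη.le (blockMean y b n)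
    rw [Real.rpow_two] at h1
    refine (ENNReal.ofReal_le_ofReal h1).trans ?_
    rw [gapSum, ENNReal.ofReal_sum_of_nonneg fun s _ => Finset.sum_nonneg fun q _ => by positivity]
    refine Finset.sum_le_sum fun s hs => ?_
    rw [ENNReal.ofReal_sum_of_nonneg fun q _ => by positivity]
    refine Finset.sum_le_sum fun q _ => ?_
    rw [ENNReal.ofReal_div_of_pos (hδ s (Finset.mem_filter.1 hs).2), div_eq_mul_inv,
      Real.mul_rpow zero_le_two (abs_nonneg _), ENNReal.ofReal_mul (by positivity)]
    gcongr
  refine (lintegral_mono hpt).trans ?_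
  rw [lintegral_finsetSum' _ fun s _ => Finset.aemeasurable_fun_sum _ fun q _ => by fun_prop,
    Finset.mul_sum]
  refine Finset.sum_le_sum fun s hs => ?_
  rw [lintegral_finsetSum' _ fun q _ => by fun_prop, Finset.mul_sum]
  refine Finset.sum_le_sum fun q _ => ?_
  rw [lintegral_mul_const' _ _ (ENNReal.inv_ne_top.2 (by
      simpa using hδ s (Finset.mem_filter.1 hs).2)), lintegral_const_mul' _ _ ENNReal.ofReal_ne_top]
  simp only [ENNReal.div_eq_inv_mul]
  rw [mul_comm, mul_left_comm (ENNReal.ofReal (176 * _))]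
  refine mul_le_mul' le_rfl ?_
  calc ENNReal.ofReal 8 * ∫⁻ y, ENNReal.ofReal (|blockMean y b n q - meanVec lam q| ^ (2 + η))
        ∂(iidLaw lam)
      ≤ ENNReal.ofReal 8 * (ENNReal.ofReal (22 * (n : ℝ) ^ (-((2 + η) / 2))) *
        ∫⁻ z, ENNReal.ofReal (|z q - meanVec lam q| ^ (2 + η)) ∂lam) := by
        gcongr
        exact lintegral_abs_blockMean_sub_rpow_le (h q) b hn (by linarith) (by linarith)
    _ = _ := by
        rw [← mul_assoc, ← ENNReal.ofReal_mul (by norm_num)]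
        congr 2; ring

lemma lintegral_sq_antitheticDiff_le (h : ∀ q, MemLp (fun z => z q) 2 lam) (hP : 0 < P)
    (hgap : ∀ s : Fin P, 0 < s.val → runMax (meanVec lam) s.val ≠ meanVec lam s)
    {η : ℝ} (hη : 0 < η) (hη' : η ≤ 1) {n : ℕ} (hn : 0 < n) :
    ∫⁻ y, ENNReal.ofReal (antitheticDiff n y ^ 2) ∂(iidLaw lam) ≤
      ENNReal.ofReal (528 * (n : ℝ) ^ (-((2 + η) / 2))) *
        ∑ s : Fin P with 0 < s.val, ∑ q ∈ Finset.Iic s,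
          (∫⁻ z, ENNReal.ofReal (|z q - meanVec lam q| ^ (2 + η)) ∂lam) /
            ENNReal.ofReal (|meanVec lam s - runMax (meanVec lam) s.val| ^ η) := by
  obtain ⟨a, -, ha⟩ := exists_argmax_gap_le hP (meanVec lam)
  have hn0 : (0 : ℝ) < n := by exact_mod_cast hn
  set H := ∑ s : Fin P with 0 < s.val, ∑ q ∈ Finset.Iic s,
    (∫⁻ z, ENNReal.ofReal (|z q - meanVec lam q| ^ (2 + η)) ∂lam) /
      ENNReal.ofReal (|meanVec lam s - runMax (meanVec lam) s.val| ^ η)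
  have hblock := fun (b k : ℕ) (hk : 0 < k) =>
    lintegral_sq_overshoot_le h hP hgap hη hη' ha b hk
  have h2 : ENNReal.ofReal (176 * ((2 * n : ℕ) : ℝ) ^ (-((2 + η) / 2))) * H ≤
      ENNReal.ofReal (176 * (n : ℝ) ^ (-((2 + η) / 2))) * H := by
    -- The mean over `2 n` samples is controlled by the bound for `n` samples.
    gcongr ?_ * H
    refine ENNReal.ofReal_le_ofReal (mul_le_mul_of_nonneg_left ?_ (by norm_num))
    exact Real.rpow_le_rpow_of_nonpos hn0 (by push_cast; linarith) (by linarith)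
  calc ∫⁻ y, ENNReal.ofReal (antitheticDiff n y ^ 2) ∂(iidLaw lam)
      ≤ ∫⁻ y, (ENNReal.ofReal ((blockMax y 0 (2 * n) - blockMean y 0 (2 * n) a) ^ 2) +
          ENNReal.ofReal ((blockMax y 0 n - blockMean y 0 n a) ^ 2) +
          ENNReal.ofReal ((blockMax y n n - blockMean y n n a) ^ 2)) ∂(iidLaw lam) := by
        refine lintegral_mono fun y => ?_
        rw [← ENNReal.ofReal_add (sq_nonneg _) (sq_nonneg _),
          ← ENNReal.ofReal_add (by positivity) (sq_nonneg _)]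
        exact ENNReal.ofReal_le_ofReal (sq_antitheticDiff_le n y a)
    _ = ∫⁻ y, ENNReal.ofReal ((blockMax y 0 (2 * n) - blockMean y 0 (2 * n) a) ^ 2) ∂(iidLaw lam) +
          ∫⁻ y, ENNReal.ofReal ((blockMax y 0 n - blockMean y 0 n a) ^ 2) ∂(iidLaw lam) +
          ∫⁻ y, ENNReal.ofReal ((blockMax y n n - blockMean y n n a) ^ 2) ∂(iidLaw lam) := by
        rw [lintegral_add_right _ (by fun_prop), lintegral_add_right _ (by fun_prop)]
    _ ≤ ENNReal.ofReal (176 * (n : ℝ) ^ (-((2 + η) / 2))) * H +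
          ENNReal.ofReal (176 * (n : ℝ) ^ (-((2 + η) / 2))) * H +
          ENNReal.ofReal (176 * (n : ℝ) ^ (-((2 + η) / 2))) * H :=
        add_le_add (add_le_add ((hblock 0 (2 * n) (by omega)).trans h2) (hblock 0 n hn))
          (hblock n n hn)
    _ = _ := by
        rw [← add_mul, ← add_mul, ← ENNReal.ofReal_add (by positivity) (by positivity),
          ← ENNReal.ofReal_add (by positivity) (by positivity)]
        congr 2; ring

lemma integral_sq_blockMax_sub_le (h : ∀ q, MemLp (fun z => z q) 2 lam) (hP : 0 < P) {n : ℕ}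
    (hn : 0 < n) :
    ∫ y, (blockMax y 0 n - runMax (meanVec lam) P) ^ 2 ∂(iidLaw lam) ≤
      P * ∑ q, Var[fun z => z q; lam] := by
  have hi : ∀ q, Integrable (fun y => (blockMean y 0 n q - meanVec lam q) ^ 2) (iidLaw lam) :=
    fun q => ((memLp_blockMean (h q) 0 n).sub (memLp_const _)).integrable_sq
  calc ∫ y, (blockMax y 0 n - runMax (meanVec lam) P) ^ 2 ∂(iidLaw lam)
      ≤ ∫ y, P * ∑ q, (blockMean y 0 n q - meanVec lam q) ^ 2 ∂(iidLaw lam) := by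
        refine integral_mono ((memLp_blockMax h hP 0 n).sub (memLp_const _)).integrable_sq
          ((integrable_finsetSum _ fun q _ => hi q).const_mul _) fun y => ?_
        have h1 := abs_runMax_sub_runMax_le hP (blockMean y 0 n) (meanVec lam)
        have h2 := sq_sum_le_card_mul_sum_sq (s := Finset.univ)
          (f := fun q => |blockMean y 0 n q - meanVec lam q|)
        simp only [sq_abs, Finset.card_univ, Fintype.card_fin] at h2
        refine le_trans ?_ h2
        rw [← sq_abs]
        exact pow_le_pow_left₀ (abs_nonneg _) h1 2
    _ = P * ∑ q, Var[fun z => z q; lam] / n := by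
        rw [integral_const_mul, integral_finsetSum _ fun q _ => hi q]
        simp only [integral_sq_blockMean_sub (h _) 0 hn]
    _ ≤ P * ∑ q, Var[fun z => z q; lam] := by
        gcongr with q
        exact div_le_self (variance_nonneg _ _) (by exact_mod_cast hn)

end Blocks

/-! ### The law of nested samples -/

section Nested

variable {G : Type*} [MeasurableSpace G] {P : ℕ}

/-- The kernel that draws a sequence of independent samples of `κ x`. -/
noncomputable def iidKernel (κ : Kernel G (Fin P → ℝ)) [IsMarkovKernel κ] :
    Kernel G (ℕ → Fin P → ℝ) where
  toFun x := iidLaw (κ x)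
  measurable' := by
    refine Measurable.measure_of_isPiSystem_of_isProbabilityMeasure
      (generateFrom_squareCylinders).symm
      (isPiSystem_squareCylinders (fun _ => MeasurableSpace.isPiSystem_measurableSet)
        fun _ => by simp) ?_
    rintro _ ⟨s, t, ht, rfl⟩
    have ht' : ∀ i, MeasurableSet (t i) := fun i => ht i (Set.mem_univ i)
    simp only [Measure.infinitePi_pi _ (fun i _ => ht' i)]
    exact Finset.measurable_fun_prod _ fun i _ => κ.measurable_coe (ht' i)

@[simp]
lemma iidKernel_apply (κ : Kernel G (Fin P → ℝ)) [IsMarkovKernel κ] (x : G) :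
    iidKernel κ x = iidLaw (κ x) := rfl

instance (κ : Kernel G (Fin P → ℝ)) [IsMarkovKernel κ] : IsMarkovKernel (iidKernel κ) :=
  ⟨fun x => by rw [iidKernel_apply]; infer_instance⟩

/-- The joint law of an outer sample and an infinite sequence of inner samples that are independent
given the outer one. -/
noncomputable def pathLaw (ρ : Measure G) (κ : Kernel G (Fin P → ℝ)) [IsMarkovKernel κ] :
    Measure (G × (ℕ → Fin P → ℝ)) :=
  ρ ⊗ₘ iidKernel κ

instance (ρ : Measure G) [IsProbabilityMeasure ρ] (κ : Kernel G (Fin P → ℝ)) [IsMarkovKernel κ] :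
    IsProbabilityMeasure (pathLaw ρ κ) := by
  unfold pathLaw; infer_instance

/-- Keep the first `n` inner samples. -/
def keepInner (n : ℕ) (p : G × (ℕ → Fin P → ℝ)) : G × (Fin n → Fin P → ℝ) :=
  (p.1, fun k => p.2 k)

/-- Extend finitely many inner samples by zero. -/
def extendInner (n : ℕ) (p : G × (Fin n → Fin P → ℝ)) : G × (ℕ → Fin P → ℝ) :=
  (p.1, fun k => if h : k < n then p.2 ⟨k, h⟩ else 0)

@[fun_prop]
lemma measurable_keepInner (n : ℕ) :
    Measurable (keepInner n : G × (ℕ → Fin P → ℝ) → G × (Fin n → Fin P → ℝ)) := by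
  unfold keepInner
  fun_prop

@[fun_prop]
lemma measurable_extendInner (n : ℕ) :
    Measurable (extendInner n : G × (Fin n → Fin P → ℝ) → G × (ℕ → Fin P → ℝ)) := by
  unfold extendInner
  refine measurable_fst.prodMk (measurable_pi_lambda _ fun k => ?_)
  by_cases h : k < n
  · simp only [h, dite_true]; fun_prop
  · simp only [h, dite_false]; fun_prop

lemma map_keepInner_pathLaw_apply (ρ : Measure G) [IsProbabilityMeasure ρ]
    (κ : Kernel G (Fin P → ℝ)) [IsMarkovKernel κ] (n : ℕ) {A : Set G} (hA : MeasurableSet A)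
    {B : Fin n → Set (Fin P → ℝ)} (hB : ∀ k, MeasurableSet (B k)) :
    (pathLaw ρ κ).map (keepInner n) (A ×ˢ Set.univ.pi B) = ∫⁻ x in A, ∏ k, κ x (B k) ∂ρ := by
  set B' : ℕ → Set (Fin P → ℝ) := fun k => if h : k < n then B ⟨k, h⟩ else Set.univ with hB'
  have hB'm : ∀ k, MeasurableSet (B' k) := fun k => by
    by_cases h : k < n
    · simpa [hB', h] using hB ⟨k, h⟩
    · simp [hB', h]
  have hpre : (keepInner n : G × (ℕ → Fin P → ℝ) → _) ⁻¹' (A ×ˢ Set.univ.pi B) =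
      A ×ˢ Set.pi (Finset.range n) B' := by
    ext p
    simp only [keepInner, Set.mem_preimage, Set.mem_prod, Set.mem_pi,
      Finset.coe_range, Set.mem_Iio, hB']
    refine and_congr_right fun _ => ⟨fun h k hk => ?_, fun h k => ?_⟩
    · simpa [hk] using h ⟨k, hk⟩
    · simpa using h k k.2
  rw [Measure.map_apply (by fun_prop) (hA.prod (MeasurableSet.univ_pi hB)), hpre, pathLaw,
    Measure.compProd_apply_prod hA
      (MeasurableSet.pi (Finset.countable_toSet _) fun k _ => hB'm k)]
  refine lintegral_congr fun x => ?_
  rw [iidKernel_apply, Measure.infinitePi_pi _ (fun k _ => hB'm k), Finset.prod_range]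
  refine Finset.prod_congr rfl fun k _ => ?_
  simp [hB']

/-- The pairs formed by an outer sample and its inner samples are independent copies of the head of
`pathLaw ρ κ`: on products of rectangles, the conditional law of the inner samples turns the
probability into the expectation of a product of functions of the independent outer samples. -/
lemma IsNestedSample.map_eq_pi {Ω' : Type*} [MeasurableSpace Ω'] {ρ : Measure G}
    [IsProbabilityMeasure ρ] {κ : Kernel G (Fin P → ℝ)} [IsMarkovKernel κ] {L : ℕ} {J K : ℕ → ℕ}
    {ν : Measure Ω'} [IsProbabilityMeasure ν] {X : ℕ → ℕ → Ω' → G}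
    {Y : ℕ → ℕ → ℕ → Ω' → Fin P → ℝ} (h : IsNestedSample ρ κ L J K ν X Y) {l : ℕ} (hl : l ≤ L) :
    ν.map (fun ω (j : Fin (J l)) => (X l j ω, fun k : Fin (K l) => Y l j k ω)) =
      Measure.pi fun _ : Fin (J l) => (pathLaw ρ κ).map (keepInner (K l)) := by
  have hXm : ∀ j : Fin (J l), Measurable (X l j) := fun j => h.measurable_outer l hl j j.2
  have hYm : ∀ (j : Fin (J l)) (k : Fin (K l)), Measurable (Y l j k) := fun j k =>
    h.measurable_inner l hl j j.2 k k.2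
  have hZm : Measurable (fun ω (j : Fin (J l)) => (X l j ω, fun k : Fin (K l) => Y l j k ω)) :=
    measurable_pi_lambda _ fun j => (hXm j).prodMk (measurable_pi_lambda _ fun k => hYm j k)
  have : IsProbabilityMeasure ((pathLaw ρ κ).map (keepInner (K l))) :=
    Measure.isProbabilityMeasure_map (by fun_prop)
  set C : Set (Set (G × (Fin (K l) → Fin P → ℝ))) := Set.image2 (· ×ˢ ·) {s | MeasurableSet s}
    (Set.univ.pi '' Set.univ.pi fun _ : Fin (K l) => {s : Set (Fin P → ℝ) | MeasurableSet s})
  have hCuniv : Set.univ ∈ C := ⟨Set.univ, by simp, Set.univ,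
    ⟨fun _ => Set.univ, fun _ _ => by simp, Set.pi_univ _⟩, by simp⟩
  symm
  refine Measure.pi_eq_generateFrom (C := fun _ => C) (fun _ => ?_) (fun _ => ?_)
    (fun _ => ⟨fun _ => Set.univ, fun _ => hCuniv, fun _ => measure_lt_top _ _,
      Set.iUnion_const _⟩) ?_
  · exact generateFrom_eq_prod MeasurableSpace.generateFrom_measurableSet generateFrom_pi
      isCountablySpanning_measurableSet
      ⟨fun _ => Set.univ, fun _ => ⟨fun _ => Set.univ, fun _ _ => by simp, Set.pi_univ _⟩,
        Set.iUnion_const _⟩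
  · exact MeasurableSpace.isPiSystem_measurableSet.prod isPiSystem_pi
  intro s hs
  choose A hA T hT hAT using hs
  choose B hB hBT using hT
  have hB' : ∀ j k, MeasurableSet (B j k) := fun j k => hB j k (Set.mem_univ k)
  have hs' : ∀ j, s j = A j ×ˢ Set.univ.pi (B j) := fun j => by rw [← hAT j, ← hBT j]
  have hsm : ∀ j, MeasurableSet (s j) := fun j => by
    rw [hs' j]; exact (hA j).prod (MeasurableSet.univ_pi (hB' j))
  set g : Fin (J l) → G → ℝ≥0∞ := fun j => (A j).indicator fun x => ∏ k, κ x (B j k) with hg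
  have hgm : ∀ j, Measurable (g j) := fun j =>
    (Finset.measurable_fun_prod _ fun k _ => κ.measurable_coe (hB' j k)).indicator (hA j)
  have hmem : {ω | (fun j : Fin (J l) => X l j ω) ∈ Set.univ.pi A} =
      ⋂ j : Fin (J l), X l j ⁻¹' A j := by
    ext ω; simp
  have hmeas : MeasurableSet {ω | (fun j : Fin (J l) => X l j ω) ∈ Set.univ.pi A} := by
    rw [hmem]; exact MeasurableSet.iInter fun j => hXm j (hA j)
  rw [Measure.map_apply hZm (MeasurableSet.univ_pi hsm)]
  have hset : (fun ω (j : Fin (J l)) => (X l j ω, fun k : Fin (K l) => Y l j k ω)) ⁻¹'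
      Set.univ.pi s = {ω | (fun j : Fin (J l) => X l j ω) ∈ Set.univ.pi A ∧
        ∀ (j : Fin (J l)) (k : Fin (K l)), Y l j k ω ∈ B j k} := by
    ext ω
    simp only [hs', Set.mem_preimage, Set.mem_univ_pi, Set.mem_prod, Set.mem_ofPred_eq]
    exact forall_and
  rw [hset, h.law_inner l hl _ (MeasurableSet.univ_pi hA) B hB', ← lintegral_indicator hmeas]
  have hind : ∀ ω, ({ω | (fun j : Fin (J l) => X l j ω) ∈ Set.univ.pi A}).indicator
      (fun ω => ∏ j : Fin (J l), ∏ k : Fin (K l), κ (X l j ω) (B j k)) ω =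
      ∏ j, g j (X l j ω) := by
    intro ω
    by_cases hω : ∀ j : Fin (J l), X l j ω ∈ A j
    · rw [Set.indicator_of_mem (by simpa using hω)]
      exact Finset.prod_congr rfl fun j _ => by rw [hg]; simp [hω j]
    · rw [Set.indicator_of_notMem (by simpa using hω)]
      obtain ⟨j, hj⟩ := not_forall.1 hω
      exact (Finset.prod_eq_zero (Finset.mem_univ j) (by rw [hg]; simp [hj])).symm
  simp only [hind]
  rw [lintegral_prod_eq_prod_lintegral_of_indepFun Finset.univ
    (fun (j : Fin (J l)) ω => g j (X l j ω))
    ((h.indep_outer l hl).comp g hgm) fun j => (hgm j).comp (hXm j)]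
  refine Finset.prod_congr rfl fun j _ => ?_
  rw [hs' j, map_keepInner_pathLaw_apply ρ κ _ (hA j) (hB' j), ← lintegral_indicator (hA j),
    ← h.law_outer l hl j j.2, lintegral_map (hgm j) (hXm j)]

end Nested

section Levels

variable {G : Type*} [MeasurableSpace G] {P : ℕ}

/-! ### Bias and variance of one level under the path law -/

/-- A shift of the indices preserves the law of a sequence of independent samples. -/
lemma integral_blockMax_shift (lam : Measure (Fin P → ℝ)) [IsProbabilityMeasure lam] (a n : ℕ) :
    ∫ y, blockMax y a n ∂(iidLaw lam) = ∫ y, blockMax y 0 n ∂(iidLaw lam) := by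
  have hmap : (iidLaw lam).map (fun y k => y (a + k)) = iidLaw lam := by
    have hind : iIndepFun (fun (k : ℕ) (y : ℕ → Fin P → ℝ) => y (a + k)) (iidLaw lam) :=
      (iIndepFun_infinitePi (P := fun _ : ℕ => lam) (X := fun _ z => z)
        fun _ => measurable_id).precomp (g := fun k => a + k) (add_right_injective a)
    rw [hind.map_fun_eq_infinitePi_map (fun k => by fun_prop)]
    simp only [(measurePreserving_eval_iidLaw (lam := lam) _).map_eq]
  have h := integral_map (μ := iidLaw lam) (φ := fun (y : ℕ → Fin P → ℝ) k => y (a + k))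
    (Measurable.aemeasurable (by fun_prop)) (f := fun y => blockMax y 0 n)
    (measurable_blockMax 0 n).aestronglyMeasurable
  rw [hmap] at h
  rw [h]
  refine integral_congr_ae (Filter.Eventually.of_forall fun y => ?_)
  refine congrArg (fun v => runMax v P) (funext fun p => ?_)
  simp [blockMean]

lemma integral_antitheticDiff {lam : Measure (Fin P → ℝ)} [IsProbabilityMeasure lam]
    (h : ∀ q, MemLp (fun z => z q) 2 lam) (hP : 0 < P) (n : ℕ) :
    ∫ y, antitheticDiff n y ∂(iidLaw lam) =
      ∫ y, blockMax y 0 (2 * n) ∂(iidLaw lam) - ∫ y, blockMax y 0 n ∂(iidLaw lam) := by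
  have hi := fun a k => (memLp_blockMax h hP a k).integrable one_le_two
  have hs : Integrable (fun y => blockMax y 0 n + blockMax y n n) (iidLaw lam) :=
    (hi 0 n).add (hi n n)
  unfold antitheticDiff
  rw [integral_sub (hi 0 (2 * n)) (hs.div_const 2), integral_div, integral_add (hi 0 n) (hi n n),
    integral_blockMax_shift lam n n]
  ring

variable {κ : Kernel G (Fin P → ℝ)}

lemma measurable_meanVec : Measurable fun x => meanVec (κ x) :=
  measurable_pi_lambda _ fun p =>
    (StronglyMeasurable.integral_kernel (κ := κ) (f := fun z : Fin P → ℝ => z p)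
      (measurable_pi_apply p).stronglyMeasurable).measurable

variable [IsMarkovKernel κ]

variable {ρ : Measure G} [IsProbabilityMeasure ρ] {φ : G → ℝ}

lemma lintegral_pathLaw {f : G × (ℕ → Fin P → ℝ) → ℝ≥0∞} (hf : Measurable f) :
    ∫⁻ p, f p ∂(pathLaw ρ κ) = ∫⁻ x, ∫⁻ y, f (x, y) ∂(iidLaw (κ x)) ∂ρ := by
  rw [pathLaw, Measure.lintegral_compProd hf]
  rfl

lemma integral_pathLaw {f : G × (ℕ → Fin P → ℝ) → ℝ} (hf : Integrable f (pathLaw ρ κ)) :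
    ∫ p, f p ∂(pathLaw ρ κ) = ∫ x, ∫ y, f (x, y) ∂(iidLaw (κ x)) ∂ρ := by
  rw [pathLaw, Measure.integral_compProd hf]
  rfl

lemma integrable_integral_pathLaw {f : G × (ℕ → Fin P → ℝ) → ℝ} (hf : Integrable f (pathLaw ρ κ)) :
    Integrable (fun x => ∫ y, f (x, y) ∂(iidLaw (κ x))) ρ :=
  Integrable.integral_compProd (κ := Kernel.const Unit ρ)
    (η := Kernel.prodMkLeft Unit (iidKernel κ)) (a := ()) hf

lemma memLp_two_of_lintegral_lt_top {α : Type*} [MeasurableSpace α] {μ : Measure α} {f : α → ℝ}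
    (hf : Measurable f) (h : ∫⁻ a, ENNReal.ofReal (f a ^ 2) ∂μ < ∞) : MemLp f 2 μ :=
  (memLp_two_iff_integrable_sq hf.aestronglyMeasurable).2
    ⟨(hf.pow_const 2).aestronglyMeasurable, (hasFiniteIntegral_iff_ofReal
      (Filter.Eventually.of_forall fun _ => sq_nonneg _)).2 h⟩

/-- The deviation of the empirical maximum from the conditional one has a conditional second moment
of order `∑ σ_q ^ 2`. -/
lemma memLp_blockMax_mul (hP : 0 < P) (hφ : Measurable φ)
    (h2 : ∀ᵐ x ∂ρ, ∀ q, MemLp (fun z => z q) 2 (κ x))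
    (hS : Integrable (fun x => (∑ q, Var[fun z => z q; κ x]) * φ x ^ 2) ρ)
    (hM : MemLp (fun x => runMax (meanVec (κ x)) P * φ x) 2 ρ) {n : ℕ} (hn : 0 < n) :
    MemLp (fun p : G × (ℕ → Fin P → ℝ) => blockMax p.2 0 n * φ p.1) 2 (pathLaw ρ κ) := by
  have hfst : MeasurePreserving Prod.fst (pathLaw ρ κ) ρ :=
    ⟨measurable_fst, Measure.fst_compProd ρ (iidKernel κ)⟩
  have h1 : MemLp (fun p : G × (ℕ → Fin P → ℝ) => runMax (meanVec (κ p.1)) P * φ p.1) 2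
      (pathLaw ρ κ) := hM.comp_measurePreserving hfst
  have hmeas : Measurable fun p : G × (ℕ → Fin P → ℝ) =>
      (blockMax p.2 0 n - runMax (meanVec (κ p.1)) P) * φ p.1 :=
    (((measurable_blockMax 0 n).comp measurable_snd).sub
      ((measurable_runMax P).comp (measurable_meanVec.comp measurable_fst))).mul
      (hφ.comp measurable_fst)
  have h3 : MemLp (fun p : G × (ℕ → Fin P → ℝ) =>
      (blockMax p.2 0 n - runMax (meanVec (κ p.1)) P) * φ p.1) 2 (pathLaw ρ κ) := by
    refine memLp_two_of_lintegral_lt_top hmeas ?_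
    rw [lintegral_pathLaw (hmeas.pow_const 2).ennreal_ofReal]
    have hfin := (hS.const_mul (P : ℝ)).lintegral_lt_top
    refine lt_of_le_of_lt (lintegral_mono_ae ?_) hfin
    filter_upwards [h2] with x hx
    have hi : Integrable (fun y => ((blockMax y 0 n - runMax (meanVec (κ x)) P) * φ x) ^ 2)
        (iidLaw (κ x)) := by
      simp only [mul_pow]
      exact ((memLp_blockMax hx hP 0 n).sub (memLp_const _)).integrable_sq.mul_const _
    rw [← ofReal_integral_eq_lintegral_ofReal hi (Filter.Eventually.of_forall fun _ =>
      sq_nonneg _)]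
    refine ENNReal.ofReal_le_ofReal ?_
    simp only [mul_pow]
    rw [integral_mul_const, ← mul_assoc]
    exact mul_le_mul_of_nonneg_right (integral_sq_blockMax_sub_le hx hP hn) (sq_nonneg _)
  refine (h3.add h1).ae_eq (Filter.Eventually.of_forall fun p => ?_)
  simp only [Pi.add_apply]
  ring

lemma abs_integral_blockMax_mul_sub_le (hP : 0 < P)
    (h2 : ∀ᵐ x ∂ρ, ∀ q, MemLp (fun z => z q) 2 (κ x))
    (hgap : ∀ᵐ x ∂ρ, ∀ s : Fin P, 0 < s.val → runMax (meanVec (κ x)) s.val ≠ meanVec (κ x) s)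
    {η : ℝ} (hη : 0 < η) (hη' : η ≤ 1)
    (hC : Integrable (fun x => (2 ^ η * (∑ q, √(Var[fun z => z q; κ x]) ^ (1 + η)) *
      ∑ s : Fin P with 0 < s.val,
        1 / |meanVec (κ x) s - runMax (meanVec (κ x)) s.val| ^ η) * |φ x|) ρ)
    (hM : Integrable (fun x => runMax (meanVec (κ x)) P * φ x) ρ) {n : ℕ} (hn : 0 < n)
    (hB : Integrable (fun p : G × (ℕ → Fin P → ℝ) => blockMax p.2 0 n * φ p.1) (pathLaw ρ κ)) :
    |∫ p, blockMax p.2 0 n * φ p.1 ∂(pathLaw ρ κ) - ∫ x, runMax (meanVec (κ x)) P * φ x ∂ρ| ≤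
      2 * (n : ℝ) ^ (-((1 + η) / 2)) *
        ∫ x, (2 ^ η * (∑ q, √(Var[fun z => z q; κ x]) ^ (1 + η)) *
          ∑ s : Fin P with 0 < s.val,
            1 / |meanVec (κ x) s - runMax (meanVec (κ x)) s.val| ^ η) * |φ x| ∂ρ := by
  have hi := integrable_integral_pathLaw hB
  rw [integral_pathLaw hB, ← integral_sub hi hM, ← integral_const_mul, ← Real.norm_eq_abs]
  refine norm_integral_le_of_norm_le (hC.const_mul _) ?_
  filter_upwards [h2, hgap] with x hx hgx
  simp only [integral_mul_const]
  rw [← sub_mul, Real.norm_eq_abs, abs_mul, ← mul_assoc]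
  exact mul_le_mul_of_nonneg_right (abs_integral_blockMax_sub_le hx hP hgx hη hη' hn)
    (abs_nonneg _)

lemma lintegral_sq_antitheticDiff_mul_le (hP : 0 < P) (hφ : Measurable φ)
    (h2 : ∀ᵐ x ∂ρ, ∀ q, MemLp (fun z => z q) 2 (κ x))
    (hgap : ∀ᵐ x ∂ρ, ∀ s : Fin P, 0 < s.val → runMax (meanVec (κ x)) s.val ≠ meanVec (κ x) s)
    {η : ℝ} (hη : 0 < η) (hη' : η ≤ 1) {n : ℕ} (hn : 0 < n) :
    ∫⁻ p, ENNReal.ofReal ((antitheticDiff n p.2 * φ p.1) ^ 2) ∂(pathLaw ρ κ) ≤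
      ENNReal.ofReal (528 * (n : ℝ) ^ (-((2 + η) / 2))) *
        ∫⁻ x, (∑ s : Fin P with 0 < s.val, ∑ q ∈ Finset.Iic s,
          (∫⁻ z, ENNReal.ofReal (|z q - meanVec (κ x) q| ^ (2 + η)) ∂(κ x)) /
            ENNReal.ofReal (|meanVec (κ x) s - runMax (meanVec (κ x)) s.val| ^ η)) *
          ENNReal.ofReal (φ x ^ 2) ∂ρ := by
  rw [lintegral_pathLaw (by fun_prop), ← lintegral_const_mul' _ _ ENNReal.ofReal_ne_top]
  refine lintegral_mono_ae ?_
  filter_upwards [h2, hgap] with x hx hgx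
  simp only [mul_pow, ENNReal.ofReal_mul (sq_nonneg _)]
  rw [lintegral_mul_const' _ _ ENNReal.ofReal_ne_top, ← mul_assoc]
  exact mul_le_mul' (lintegral_sq_antitheticDiff_le hx hP hgx hη hη' hn) le_rfl

lemma integral_antitheticDiff_mul (hP : 0 < P)
    (h2 : ∀ᵐ x ∂ρ, ∀ q, MemLp (fun z => z q) 2 (κ x)) {n : ℕ}
    (hA : Integrable (fun p : G × (ℕ → Fin P → ℝ) => antitheticDiff n p.2 * φ p.1) (pathLaw ρ κ))
    (h1 : Integrable (fun p : G × (ℕ → Fin P → ℝ) => blockMax p.2 0 n * φ p.1) (pathLaw ρ κ))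
    (h3 : Integrable (fun p : G × (ℕ → Fin P → ℝ) => blockMax p.2 0 (2 * n) * φ p.1)
      (pathLaw ρ κ)) :
    ∫ p, antitheticDiff n p.2 * φ p.1 ∂(pathLaw ρ κ) =
      ∫ p, blockMax p.2 0 (2 * n) * φ p.1 ∂(pathLaw ρ κ) -
        ∫ p, blockMax p.2 0 n * φ p.1 ∂(pathLaw ρ κ) := by
  rw [integral_pathLaw hA, integral_pathLaw h1, integral_pathLaw h3,
    ← integral_sub (integrable_integral_pathLaw h3) (integrable_integral_pathLaw h1)]
  refine integral_congr_ae ?_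
  filter_upwards [h2] with x hx
  simp only [integral_mul_const]
  rw [integral_antitheticDiff hx hP, sub_mul]

/-! ### Averages over the outer samples of one level -/

/-- The data of level `l`: the outer samples and their inner samples. -/
def levelData {Ω' : Type*} (J K : ℕ → ℕ) (X : ℕ → ℕ → Ω' → G)
    (Y : ℕ → ℕ → ℕ → Ω' → Fin P → ℝ) (l : ℕ) (ω : Ω') :
    (Fin (J l) → G) × (Fin (J l) → Fin (K l) → Fin P → ℝ) :=
  (fun j => X l j ω, fun j k => Y l j k ω)

/-- The average of `F` over the outer samples of a level, as a function of the level's data. -/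
noncomputable def levelMean (J n : ℕ) (F : G × (ℕ → Fin P → ℝ) → ℝ)
    (d : (Fin J → G) × (Fin J → Fin n → Fin P → ℝ)) : ℝ :=
  (1 / (J : ℝ)) * ∑ j, F (extendInner n (d.1 j, d.2 j))

lemma measurable_levelMean (J n : ℕ) {F : G × (ℕ → Fin P → ℝ) → ℝ} (hF : Measurable F) :
    Measurable (levelMean J n F) := by
  unfold levelMean
  fun_prop

variable {Ω' : Type*} [MeasurableSpace Ω'] {ν : Measure Ω'} [IsProbabilityMeasure ν]

/-- Averaging `J l` independent copies of `F` preserves the mean and divides the variance by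
`J l`. -/
lemma IsNestedSample.levelMean_moments {L : ℕ} {J K : ℕ → ℕ} {X : ℕ → ℕ → Ω' → G}
    {Y : ℕ → ℕ → ℕ → Ω' → Fin P → ℝ} (h : IsNestedSample ρ κ L J K ν X Y) {l : ℕ} (hl : l ≤ L)
    (hJ : 0 < J l) {F : G × (ℕ → Fin P → ℝ) → ℝ} (hF : Measurable F)
    (hF2 : MemLp F 2 (pathLaw ρ κ))
    (hFK : ∀ p, F (extendInner (K l) (keepInner (K l) p)) = F p) :
    MemLp (fun ω => levelMean (J l) (K l) F (levelData J K X Y l ω)) 2 ν ∧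
      ∫ ω, levelMean (J l) (K l) F (levelData J K X Y l ω) ∂ν = ∫ p, F p ∂(pathLaw ρ κ) ∧
      Var[fun ω => levelMean (J l) (K l) F (levelData J K X Y l ω); ν] ≤
        (∫ p, F p ^ 2 ∂(pathLaw ρ κ)) / J l := by
  set Q := (pathLaw ρ κ).map (keepInner (K l)) with hQ
  have : IsProbabilityMeasure Q := Measure.isProbabilityMeasure_map (by fun_prop)
  set F' : G × (Fin (K l) → Fin P → ℝ) → ℝ := fun p => F (extendInner (K l) p) with hF'
  have hF'm : Measurable F' := by fun_prop
  set Z : Fin (J l) → Ω' → G × (Fin (K l) → Fin P → ℝ) := fun j ω =>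
    (X l j ω, fun k : Fin (K l) => Y l j k ω) 
  have hZm : ∀ j, Measurable (Z j) := fun j => (h.measurable_outer l hl j j.2).prodMk
    (measurable_pi_lambda _ fun k => h.measurable_inner l hl j j.2 k k.2)
  have hpi : ν.map (fun ω j => Z j ω) = Measure.pi fun _ : Fin (J l) => Q := h.map_eq_pi hl
  have hlaw : ∀ j, ν.map (Z j) = Q := by
    intro j
    have h1 := (measurePreserving_eval (fun _ : Fin (J l) => Q) j).map_eq
    rw [← hpi, Measure.map_map (measurable_pi_apply j) (measurable_pi_lambda _ hZm)] at h1
    exact h1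
  have hind : iIndepFun Z ν := by
    rw [iIndepFun_iff_map_fun_eq_pi_map fun j => (hZm j).aemeasurable]
    simp only [hlaw]
    exact hpi
  have hmpK : MeasurePreserving (keepInner (K l)) (pathLaw ρ κ) Q := ⟨by fun_prop, rfl⟩
  have hmpZ : ∀ j, MeasurePreserving (Z j) ν Q := fun j => ⟨hZm j, hlaw j⟩
  have hF'2 : MemLp F' 2 Q := by
    rw [hQ, memLp_map_measure_iff hF'm.aestronglyMeasurable hmpK.measurable.aemeasurable]
    refine hF2.ae_eq (Filter.Eventually.of_forall fun p => (hFK p).symm)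
  have hint : ∀ f : ℝ → ℝ, Measurable f → ∀ j, ∫ ω, f (F' (Z j ω)) ∂ν =
      ∫ p, f (F p) ∂(pathLaw ρ κ) := by
    intro f hf j
    have e1 := integral_map (μ := ν) (hZm j).aemeasurable (f := fun p => f (F' p))
      (hf.comp hF'm).aestronglyMeasurable
    have e2 := integral_map (μ := pathLaw ρ κ) hmpK.measurable.aemeasurable
      (f := fun p => f (F' p)) (hf.comp hF'm).aestronglyMeasurable
    rw [hlaw j] at e1
    rw [← e1, hQ, e2]
    simp only [hF', hFK]
  have hL2 : ∀ j, MemLp (fun ω => F' (Z j ω)) 2 ν := fun j =>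
    hF'2.comp_measurePreserving (hmpZ j)
  have hJ0 : (0 : ℝ) < J l := by exact_mod_cast hJ
  have heq : ∀ ω, levelMean (J l) (K l) F (levelData J K X Y l ω) =
      (1 / (J l : ℝ)) * ∑ j, F' (Z j ω) := fun ω => rfl
  simp only [heq]
  refine ⟨(memLp_finsetSum _ fun j _ => hL2 j).const_mul _, ?_, ?_⟩
  · rw [integral_const_mul, integral_finsetSum _ fun j _ => (hL2 j).integrable one_le_two]
    simp only [hint (fun t => t) measurable_id]
    simp
    field_simp
  · have hvar := IndepFun.variance_sum (μ := ν) (X := fun (j : Fin (J l)) ω => F' (Z j ω))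
      (s := Finset.univ) (fun j _ => hL2 j)
      (fun i _ j _ hij => (hind.indepFun hij).comp hF'm hF'm)
    have e : (∑ j : Fin (J l), fun ω => F' (Z j ω)) = fun ω => ∑ j, F' (Z j ω) := by
      ext ω; simp
    rw [e] at hvar
    rw [variance_const_mul, hvar]
    have hle : ∀ j : Fin (J l), Var[fun ω => F' (Z j ω); ν] ≤ ∫ p, F p ^ 2 ∂(pathLaw ρ κ) :=
      fun j => (variance_le_expectation_sq (hL2 j).1).trans
        (hint (fun t => t ^ 2) (by fun_prop) j).le
    calc (1 / (J l : ℝ)) ^ 2 * ∑ j : Fin (J l), Var[fun ω => F' (Z j ω); ν]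
        ≤ (1 / (J l : ℝ)) ^ 2 * ∑ _j : Fin (J l), ∫ p, F p ^ 2 ∂(pathLaw ρ κ) := by
          gcongr with j _
          exact hle j
      _ = _ := by
          simp
          field_simp

end Levels

section Conditional

/-! ### Conditional moments through the conditional law -/

variable {Ω G : Type*} [MeasurableSpace Ω] [MeasurableSpace G] {μ : Measure Ω}
  {P : ℕ} {X : Ω → G} {Y : Ω → Fin P → ℝ}

lemma memLp_coord (hY2 : MemLp Y 2 μ) (q : Fin P) : MemLp (fun ω => Y ω q) 2 μ :=
  memLp_pi_iff.1 hY2 q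

lemma measurable_sub_meanVec {κ : Kernel G (Fin P → ℝ)} (q : Fin P) :
    Measurable fun p : G × (Fin P → ℝ) => p.2 q - meanVec (κ p.1) q :=
  ((measurable_pi_apply q).comp measurable_snd).sub
    ((measurable_pi_apply q).comp (measurable_meanVec.comp measurable_fst))

lemma measurable_variance_kernel {κ : Kernel G (Fin P → ℝ)} [IsMarkovKernel κ] (q : Fin P) :
    Measurable fun x => Var[fun z => z q; κ x] := by
  have h := StronglyMeasurable.integral_kernel_prod_right' (κ := κ)
    ((measurable_sub_meanVec (κ := κ) q).pow_const 2).stronglyMeasurable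
  have e : (fun x => Var[fun z => z q; κ x]) = fun x => ∫ z, (z q - meanVec (κ x) q) ^ 2 ∂κ x :=
    funext fun x => variance_eq_integral (measurable_pi_apply q).aemeasurable
  rw [e]
  exact h.measurable

lemma integrable_map_of_ae_eq (hX : Measurable X) {f : G → ℝ} {g : Ω → ℝ} (hf : Measurable f)
    (hg : Integrable g μ) (h : ∀ᵐ ω ∂μ, g ω = f (X ω)) : Integrable f (μ.map X) :=
  (integrable_map_measure hf.aestronglyMeasurable hX.aemeasurable).2 (hg.congr h)

variable [IsProbabilityMeasure μ]

lemma ae_memLp_condDistrib (hX : Measurable X) (hY : Measurable Y) (hY2 : MemLp Y 2 μ) :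
    ∀ᵐ x ∂(μ.map X), ∀ q, MemLp (fun z => z q) 2 (condDistrib Y X μ x) := by
  refine ae_all_iff.2 fun q => ?_
  have hi : Integrable (fun p : G × (Fin P → ℝ) => p.2 q ^ 2) (μ.map fun ω => (X ω, Y ω)) := by
    rw [integrable_map_measure (Measurable.aestronglyMeasurable (by fun_prop))
      (hX.prodMk hY).aemeasurable]
    exact (memLp_coord hY2 q).integrable_sq
  filter_upwards [hi.condDistrib_ae_map hY.aemeasurable] with x hx
  exact (memLp_two_iff_integrable_sq (measurable_pi_apply q).aestronglyMeasurable).2 hx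

lemma condMean_ae_eq (hX : Measurable X) (hY : Measurable Y) (hY2 : MemLp Y 2 μ) :
    ∀ᵐ ω ∂μ, condMean μ X Y ω = meanVec (condDistrib Y X μ (X ω)) := by
  have h : ∀ q, ∀ᵐ ω ∂μ, condMean μ X Y ω q = meanVec (condDistrib Y X μ (X ω)) q := fun q =>
    condExp_ae_eq_integral_condDistrib hX hY.aemeasurable
      (f := fun z : Fin P → ℝ => z q) (measurable_pi_apply q).stronglyMeasurable
      ((memLp_coord hY2 q).integrable one_le_two)
  filter_upwards [ae_all_iff.2 h] with ω hω
  exact funext hω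

lemma condStd_ae_eq (hX : Measurable X) (hY : Measurable Y) (hY2 : MemLp Y 2 μ) :
    ∀ᵐ ω ∂μ, ∀ q, condStd μ X Y q ω = √(Var[fun z => z q; condDistrib Y X μ (X ω)]) := by
  refine ae_all_iff.2 fun q => ?_
  have hq := memLp_coord hY2 q
  have hsq : Integrable (fun ω => (Y ω q - condMean μ X Y ω q) ^ 2) μ :=
    (hq.sub (hq.condExp (m := MeasurableSpace.comap X inferInstance) one_le_two)).integrable_sq
  have hae : (fun ω => (Y ω q - condMean μ X Y ω q) ^ 2) =ᵐ[μ]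
      fun ω => (Y ω q - meanVec (condDistrib Y X μ (X ω)) q) ^ 2 := by
    filter_upwards [condMean_ae_eq hX hY hY2] with ω hω
    rw [hω]
  have h1 : Var[fun ω' => Y ω' q; μ | MeasurableSpace.comap X inferInstance] =ᵐ[μ]
      μ[fun ω => (Y ω q - meanVec (condDistrib Y X μ (X ω)) q) ^ 2 |
        MeasurableSpace.comap X inferInstance] := condExp_congr_ae hae
  have h2 := condExp_prod_ae_eq_integral_condDistrib hX hY.aemeasurable
    (f := fun p : G × (Fin P → ℝ) => (p.2 q - meanVec (condDistrib Y X μ p.1) q) ^ 2)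
    ((measurable_sub_meanVec q).pow_const 2).stronglyMeasurable (hsq.congr hae)
  filter_upwards [h1, h2] with ω h1 h2
  rw [condStd, h1, h2, variance_eq_integral (measurable_pi_apply q).aemeasurable]
  rfl

/-- The right-hand side is a function of `X`, and both sides have the same integrals over the events
`X ∈ t`; no moment beyond the second is assumed finite. -/
lemma condCentralMoment_ae_eq (hX : Measurable X) (hY : Measurable Y) (hY2 : MemLp Y 2 μ)
    (r : ℝ) :
    ∀ᵐ ω ∂μ, ∀ q, condCentralMoment μ X Y r q ω =
      ∫⁻ z, ENNReal.ofReal (|z q - meanVec (condDistrib Y X μ (X ω)) q| ^ r)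
        ∂(condDistrib Y X μ (X ω)) := by
  refine ae_all_iff.2 fun q => ?_
  have hf : Measurable fun p : G × (Fin P → ℝ) =>
      ENNReal.ofReal (|p.2 q - meanVec (condDistrib Y X μ p.1) q| ^ r) :=
    ENNReal.measurable_ofReal.comp
      ((continuous_abs.measurable.comp (measurable_sub_meanVec q)).pow_const r)
  have h1 : condCentralMoment μ X Y r q =ᵐ[μ]
      condLExp (MeasurableSpace.comap X inferInstance) μ
        (fun ω => ENNReal.ofReal (|Y ω q - meanVec (condDistrib Y X μ (X ω)) q| ^ r)) := by
    refine condLExp_congr_ae ?_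
    filter_upwards [condMean_ae_eq hX hY hY2] with ω hω
    rw [hω]
  have h2 : (fun ω => ∫⁻ z, ENNReal.ofReal (|z q - meanVec (condDistrib Y X μ (X ω)) q| ^ r)
        ∂(condDistrib Y X μ (X ω))) =ᵐ[μ]
      condLExp (MeasurableSpace.comap X inferInstance) μ
        (fun ω => ENNReal.ofReal (|Y ω q - meanVec (condDistrib Y X μ (X ω)) q| ^ r)) := by
    have hg := hf.lintegral_kernel_prod_right' (κ := condDistrib Y X μ)
    refine ae_eq_condLExp hX.comap_le _ _ (hg.comp (comap_measurable X)) ?_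
    rintro _ ⟨t, ht, rfl⟩
    have e := setLIntegral_map ht hg hX (μ := μ)
    have e2 := Measure.setLIntegral_compProd (μ := μ.map X) (κ := condDistrib Y X μ) hf ht
      MeasurableSet.univ
    rw [compProd_map_condDistrib hY.aemeasurable, setLIntegral_map (ht.prod MeasurableSet.univ) hf
      (hX.prodMk hY)] at e2
    simp only [Measure.restrict_univ] at e2
    rw [← e, ← e2]
    simp [Set.mk_preimage_prod]
  filter_upwards [h1, h2] with ω h1 h2
  rw [h1, h2]

/-! ### The assumptions in terms of the conditional law -/

lemma ae_runMax_ne_meanVec (hX : Measurable X) (hY : Measurable Y) (hY2 : MemLp Y 2 μ)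
    (hgap : ∀ p : Fin P, 0 < p.val →
      μ {ω | condMax μ X Y p.val ω = condMean μ X Y ω p} = 0) :
    ∀ᵐ x ∂(μ.map X), ∀ s : Fin P, 0 < s.val →
      runMax (meanVec (condDistrib Y X μ x)) s.val ≠ meanVec (condDistrib Y X μ x) s := by
  refine ae_all_iff.2 fun s => ?_
  by_cases hs : 0 < s.val
  swap
  · exact Filter.Eventually.of_forall fun x h => absurd h hs
  have hm : Measurable fun x => meanVec (condDistrib Y X μ x) := measurable_meanVec
  have hset : MeasurableSet {x | runMax (meanVec (condDistrib Y X μ x)) s.val =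
      meanVec (condDistrib Y X μ x) s} :=
    measurableSet_eq_fun ((measurable_runMax _).comp hm) ((measurable_pi_apply s).comp hm)
  have h : ∀ᵐ x ∂(μ.map X), ¬ runMax (meanVec (condDistrib Y X μ x)) s.val =
      meanVec (condDistrib Y X μ x) s := by
    refine (ae_map_iff hX.aemeasurable
      (p := fun x => ¬ runMax (meanVec (condDistrib Y X μ x)) s.val =
        meanVec (condDistrib Y X μ x) s) hset.compl).2 ?_
    have h0 : ∀ᵐ ω ∂μ, ¬ condMax μ X Y s.val ω = condMean μ X Y ω s := by
      rw [ae_iff]; simpa using hgap s hs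
    filter_upwards [h0, condMean_ae_eq hX hY hY2] with ω h1 h2
    rwa [condMax, h2] at h1
  filter_upwards [h] with x hx _ using hx

variable {φ : G → ℝ}

lemma integrable_variance_mul (hX : Measurable X) (hY : Measurable Y) (hY2 : MemLp Y 2 μ)
    (hφ : Measurable φ)
    (hSigma : Integrable (fun ω => condStdSum μ X Y 2 ω * φ (X ω) ^ 2) μ) :
    Integrable (fun x => (∑ q, Var[fun z => z q; condDistrib Y X μ x]) * φ x ^ 2) (μ.map X) := by
  refine integrable_map_of_ae_eq hX ((Finset.measurable_fun_sum _ fun q _ =>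
    measurable_variance_kernel q).mul (hφ.pow_const 2)) hSigma ?_
  filter_upwards [condStd_ae_eq hX hY hY2] with ω hω
  rw [condStdSum]
  congr 1
  refine Finset.sum_congr rfl fun q _ => ?_
  rw [hω q, Real.rpow_two, Real.sq_sqrt (variance_nonneg _ _)]

lemma measurable_gap_rpow {κ : Kernel G (Fin P → ℝ)} (s : Fin P) (η : ℝ) :
    Measurable fun x => |meanVec (κ x) s - runMax (meanVec (κ x)) s.val| ^ η :=
  (continuous_abs.measurable.comp (((measurable_pi_apply s).comp measurable_meanVec).sub
    ((measurable_runMax _).comp measurable_meanVec))).pow_const η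

lemma integrable_biasWeight_mul (hX : Measurable X) (hY : Measurable Y) (hY2 : MemLp Y 2 μ)
    (hφ : Measurable φ) {η : ℝ}
    (hC : Integrable (fun ω => biasWeight μ X Y η ω * |φ (X ω)|) μ) :
    Integrable (fun x => (2 ^ η * (∑ q, √(Var[fun z => z q; condDistrib Y X μ x]) ^ (1 + η)) *
      ∑ s : Fin P with 0 < s.val, 1 / |meanVec (condDistrib Y X μ x) s -
        runMax (meanVec (condDistrib Y X μ x)) s.val| ^ η) * |φ x|) (μ.map X) := by
  refine integrable_map_of_ae_eq hX ?_ hC ?_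
  · exact ((measurable_const.mul (Finset.measurable_fun_sum _ fun q _ =>
      (measurable_variance_kernel q).sqrt.pow_const _)).mul (Finset.measurable_fun_sum _ fun s _ =>
        measurable_const.div (measurable_gap_rpow s η))).mul (continuous_abs.measurable.comp hφ)
  · filter_upwards [condStd_ae_eq hX hY hY2, condMean_ae_eq hX hY hY2] with ω h1 h2
    simp only [biasWeight, condStdSum, gap, condMax, h1, h2]

lemma memLp_runMax_mul (hX : Measurable X) (hY : Measurable Y) (hY2 : MemLp Y 2 μ)
    (hφ : Measurable φ) (hV : evariance (fun ω => condMax μ X Y P ω * φ (X ω)) μ < ∞) :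
    MemLp (fun x => runMax (meanVec (condDistrib Y X μ x)) P * φ x) 2 (μ.map X) := by
  have hf : Measurable fun x => runMax (meanVec (condDistrib Y X μ x)) P * φ x :=
    ((measurable_runMax P).comp measurable_meanVec).mul hφ
  have hae : (fun ω => condMax μ X Y P ω * φ (X ω)) =ᵐ[μ]
      fun ω => runMax (meanVec (condDistrib Y X μ (X ω))) P * φ (X ω) := by
    filter_upwards [condMean_ae_eq hX hY hY2] with ω h
    rw [condMax, h]
  have hm : AEStronglyMeasurable (fun ω => condMax μ X Y P ω * φ (X ω)) μ :=
    (hf.comp hX).aestronglyMeasurable.congr hae.symm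
  rw [memLp_map_measure_iff hf.aestronglyMeasurable hX.aemeasurable]
  exact ((evariance_lt_top_iff_memLp hm).1 hV).ae_eq hae

lemma target_eq (hX : Measurable X) (hY : Measurable Y) (hY2 : MemLp Y 2 μ) (hφ : Measurable φ) :
    target μ X Y φ = ∫ x, runMax (meanVec (condDistrib Y X μ x)) P * φ x ∂(μ.map X) := by
  have hf : Measurable fun x => runMax (meanVec (condDistrib Y X μ x)) P * φ x :=
    ((measurable_runMax P).comp measurable_meanVec).mul hφ
  rw [integral_map hX.aemeasurable hf.aestronglyMeasurable, target]
  refine integral_congr_ae ?_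
  filter_upwards [condMean_ae_eq hX hY hY2] with ω h
  rw [condMax, h]

lemma lintegral_centralMoment_mul_lt_top (hX : Measurable X) (hY : Measurable Y)
    (hY2 : MemLp Y 2 μ) (hφ : Measurable φ) {η : ℝ}
    (hD : ∀ p : Fin P, 0 < p.val → ∀ q : Fin P, q ≤ p →
      ∫⁻ ω, condCentralMoment μ X Y (2 + η) q ω / ENNReal.ofReal (gap μ X Y p ω ^ η) *
        ENNReal.ofReal (φ (X ω) ^ 2) ∂μ < ∞) :
    ∫⁻ x, (∑ s : Fin P with 0 < s.val, ∑ q ∈ Finset.Iic s,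
      (∫⁻ z, ENNReal.ofReal (|z q - meanVec (condDistrib Y X μ x) q| ^ (2 + η))
          ∂(condDistrib Y X μ x)) /
        ENNReal.ofReal (|meanVec (condDistrib Y X μ x) s -
          runMax (meanVec (condDistrib Y X μ x)) s.val| ^ η)) *
      ENNReal.ofReal (φ x ^ 2) ∂(μ.map X) < ∞ := by
  have hm : ∀ s q : Fin P, Measurable fun x =>
      (∫⁻ z, ENNReal.ofReal (|z q - meanVec (condDistrib Y X μ x) q| ^ (2 + η))
          ∂(condDistrib Y X μ x)) /
        ENNReal.ofReal (|meanVec (condDistrib Y X μ x) s -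
          runMax (meanVec (condDistrib Y X μ x)) s.val| ^ η) *
      ENNReal.ofReal (φ x ^ 2) := fun s q =>
    (((ENNReal.measurable_ofReal.comp ((continuous_abs.measurable.comp
      (measurable_sub_meanVec q)).pow_const (2 + η))).lintegral_kernel_prod_right').div
        (measurable_gap_rpow s η).ennreal_ofReal).mul (hφ.pow_const 2).ennreal_ofReal
  simp only [Finset.sum_mul]
  rw [lintegral_finsetSum _ fun s _ => Finset.measurable_fun_sum _ fun q _ => hm s q]
  refine ENNReal.sum_lt_top.2 fun s hs => ?_
  rw [lintegral_finsetSum _ fun q _ => hm s q]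
  refine ENNReal.sum_lt_top.2 fun q hq => ?_
  rw [lintegral_map (hm s q) hX]
  refine lt_of_eq_of_lt (lintegral_congr_ae ?_)
    (hD s (Finset.mem_filter.1 hs).2 q (Finset.mem_Iic.1 hq))
  filter_upwards [condMean_ae_eq hX hY hY2, condCentralMoment_ae_eq hX hY hY2 (2 + η)]
    with ω h1 h2
  rw [h2 q, gap, condMax, h1]

end Conditional

/-! ### Mean square error of the estimator -/

section Error

variable {G : Type*} {P : ℕ}

/-- The function of an outer sample and its inner samples that is averaged at level `l`: the
empirical maximum at level `0`, and the antithetic difference with blocks of length `K (l - 1)` at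
the levels `l ≥ 1`. -/
noncomputable def levelFun (φ : G → ℝ) (K : ℕ → ℕ) : ℕ → G × (ℕ → Fin P → ℝ) → ℝ
  | 0 => fun p => blockMax p.2 0 (K 0) * φ p.1
  | l + 1 => fun p => antitheticDiff (K l) p.2 * φ p.1

lemma levelFun_extendInner_keepInner (φ : G → ℝ) {K : ℕ → ℕ} (hK : ∀ l, K (l + 1) = 2 * K l)
    (l : ℕ) (p : G × (ℕ → Fin P → ℝ)) :
    levelFun φ K l (extendInner (K l) (keepInner (K l) p)) = levelFun φ K l p := by
  have h : ∀ a n, a + n ≤ K l →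
      blockMax (extendInner (K l) (keepInner (K l) p)).2 a n = blockMax p.2 a n := fun a n han =>
    blockMax_congr fun k hk => by simp [extendInner, keepInner, lt_of_lt_of_le hk han]
  have h1 : (extendInner (K l) (keepInner (K l) p)).1 = p.1 := rfl
  cases l with
  | zero => simp only [levelFun, h1, h 0 (K 0) (by omega)]
  | succ l =>
    have hl := hK l
    simp only [levelFun, antitheticDiff, h1, h 0 (2 * K l) (by omega), h 0 (K l) (by omega),
      h (K l) (K l) (by omega)]

lemma levelMean_levelData {Ω' : Type*} (J K : ℕ → ℕ) (X : ℕ → ℕ → Ω' → G)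
    (Y : ℕ → ℕ → ℕ → Ω' → Fin P → ℝ) (l : ℕ) (ω : Ω') {F : G × (ℕ → Fin P → ℝ) → ℝ}
    (hF : ∀ p, F (extendInner (K l) (keepInner (K l) p)) = F p) :
    levelMean (J l) (K l) F (levelData J K X Y l ω) =
      (1 / (J l : ℝ)) * ∑ j ∈ Finset.range (J l), F (X l j ω, fun k => Y l j k ω) := by
  rw [levelMean, Finset.sum_range]
  congr 1
  exact Finset.sum_congr rfl fun j _ => hF (X l j ω, fun k => Y l j k ω)

lemma antitheticEstimator_eq_sum {Ω' : Type*} (φ : G → ℝ) (L : ℕ) (J : ℕ → ℕ) {K : ℕ → ℕ}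
    (hK : ∀ l, K (l + 1) = 2 * K l) (X : ℕ → ℕ → Ω' → G)
    (Y : ℕ → ℕ → ℕ → Ω' → Fin P → ℝ) (ω : Ω') :
    antitheticEstimator φ L J K X Y ω =
      ∑ l : Fin (L + 1), levelMean (J l) (K l) (levelFun φ K l) (levelData J K X Y l ω) := by
  rw [← Finset.sum_range fun l => levelMean (J l) (K l) (levelFun φ K l) (levelData J K X Y l ω),
    Finset.sum_range_succ', add_comm, antitheticEstimator]
  congr 1
  · rw [levelMean_levelData J K X Y 0 ω (levelFun_extendInner_keepInner φ hK 0)]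
    rfl
  · rw [← Finset.Ico_add_one_right_eq_Icc, Finset.sum_Ico_eq_sum_range, Nat.add_sub_cancel]
    refine Finset.sum_congr rfl fun l _ => ?_
    rw [levelMean_levelData J K X Y (l + 1) ω (levelFun_extendInner_keepInner φ hK (l + 1)),
      add_comm 1 l, Nat.add_sub_cancel, hK l]
    rfl

variable [MeasurableSpace G]

lemma measurable_levelFun {φ : G → ℝ} (hφ : Measurable φ) (K : ℕ → ℕ) (l : ℕ) :
    Measurable (levelFun φ K l : G × (ℕ → Fin P → ℝ) → ℝ) := by
  cases l <;> unfold levelFun <;> fun_prop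

/-- The mean square error is the squared bias plus the variance; the variances of the independent
levels add up. -/
lemma IsNestedSample.integral_sq_error_le {Ω' : Type*} [MeasurableSpace Ω'] {ν : Measure Ω'}
    [IsProbabilityMeasure ν] {ρ : Measure G} [IsProbabilityMeasure ρ]
    {κ : Kernel G (Fin P → ℝ)} [IsMarkovKernel κ] {φ : G → ℝ} (hφ : Measurable φ) {L : ℕ}
    {J K : ℕ → ℕ} {X : ℕ → ℕ → Ω' → G} {Y : ℕ → ℕ → ℕ → Ω' → Fin P → ℝ}
    (h : IsNestedSample ρ κ L J K ν X Y) (hJ : ∀ l, 0 < J l) (hK : ∀ l, K (l + 1) = 2 * K l)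
    (hF : ∀ l, MemLp (levelFun φ K l) 2 (pathLaw ρ κ)) (c : ℝ) :
    Integrable (fun ω => (antitheticEstimator φ L J K X Y ω - c) ^ 2) ν ∧
      ∫ ω, (antitheticEstimator φ L J K X Y ω - c) ^ 2 ∂ν ≤
        ∑ l ∈ Finset.range (L + 1), (∫ p, levelFun φ K l p ^ 2 ∂(pathLaw ρ κ)) / J l +
          (∑ l ∈ Finset.range (L + 1), ∫ p, levelFun φ K l p ∂(pathLaw ρ κ) - c) ^ 2 := by
  set A : Fin (L + 1) → Ω' → ℝ := fun l ω =>
    levelMean (J l) (K l) (levelFun φ K l) (levelData J K X Y l ω) with hA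
  have hmom := fun l : Fin (L + 1) => h.levelMean_moments (Nat.lt_succ_iff.1 l.2) (hJ l)
    (measurable_levelFun hφ K l) (hF l) (levelFun_extendInner_keepInner φ hK l)
  have hAL : ∀ l, MemLp (A l) 2 ν := fun l => (hmom l).1
  have hind : iIndepFun A ν := h.indep_levels.comp
    (fun (l : Fin (L + 1)) => levelMean (J l) (K l) (levelFun φ K l))
    (fun l => measurable_levelMean _ _ (measurable_levelFun hφ K l))
  have hest : ∀ ω, antitheticEstimator φ L J K X Y ω = ∑ l, A l ω := fun ω =>
    antitheticEstimator_eq_sum φ L J hK X Y ω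
  simp only [hest]
  have hS : MemLp (fun ω => ∑ l, A l ω) 2 ν := memLp_finsetSum _ fun l _ => hAL l
  have hSc : MemLp (fun ω => ∑ l, A l ω - c) 2 ν := hS.sub (memLp_const c)
  refine ⟨hSc.integrable_sq, ?_⟩
  have hmean : ∫ ω, (∑ l, A l ω - c) ∂ν =
      ∑ l ∈ Finset.range (L + 1), ∫ p, levelFun φ K l p ∂(pathLaw ρ κ) - c := by
    rw [integral_sub (hS.integrable one_le_two) (integrable_const c),
      integral_finsetSum _ fun l _ => (hAL l).integrable one_le_two, Finset.sum_range]
    simp only [hA, (hmom _).2.1]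
    simp
  have hvar := IndepFun.variance_sum (μ := ν) (X := A) (s := Finset.univ) (fun l _ => hAL l)
    (fun i _ j _ hij => hind.indepFun hij)
  have e : (∑ l, A l) = fun ω => ∑ l, A l ω := by ext ω; simp
  rw [e] at hvar
  have hdec := variance_eq_sub hSc
  rw [variance_sub_const hS.1, hvar] at hdec
  simp only [Pi.pow_apply] at hdec
  rw [hmean] at hdec
  have hle : ∑ l, Var[A l; ν] ≤
      ∑ l ∈ Finset.range (L + 1), (∫ p, levelFun φ K l p ^ 2 ∂(pathLaw ρ κ)) / J l := by
    rw [Finset.sum_range]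
    exact Finset.sum_le_sum fun l _ => (hmom l).2.2
  linarith

end Error

/-! ### The parameters -/

section Parameters

variable {η ε : ℝ}

lemma two_rpow_abs_log_div_log_two (h0 : 0 < ε) (h1 : ε < 1) :
    (2 : ℝ) ^ (|Real.log ε| / Real.log 2) = ε⁻¹ := by
  rw [abs_of_neg (Real.log_neg h0 h1), Real.rpow_def_of_pos two_pos,
    mul_div_cancel₀ _ (Real.log_pos one_lt_two).ne', Real.exp_neg, Real.exp_log h0]

lemma baseCount_bounds (h0 : 0 < ε) (h1 : ε < 1) :
    ε⁻¹ ^ 2 ≤ (baseCount ε : ℝ) ∧ (baseCount ε : ℝ) ≤ 2 * ε⁻¹ ^ 2 := by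
  have ht := two_rpow_abs_log_div_log_two h0 h1
  set t := |Real.log ε| / Real.log 2 with htdef
  have ht0 : 0 ≤ t := div_nonneg (abs_nonneg _) (Real.log_nonneg one_le_two)
  have e : ε⁻¹ ^ 2 = (2 : ℝ) ^ (2 * t) := by
    rw [← ht, ← Real.rpow_two, ← Real.rpow_mul zero_le_two, mul_comm]
  have hb : (baseCount ε : ℝ) = (2 : ℝ) ^ ((⌈2 * t⌉₊ : ℕ) : ℝ) := by
    rw [Real.rpow_natCast, baseCount, htdef, ← mul_div_assoc]
    push_cast
    rfl
  rw [e, hb]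
  refine ⟨Real.rpow_le_rpow_of_exponent_le one_le_two (Nat.le_ceil _), ?_⟩
  calc (2 : ℝ) ^ ((⌈2 * t⌉₊ : ℕ) : ℝ) ≤ 2 ^ (2 * t + 1) :=
        Real.rpow_le_rpow_of_exponent_le one_le_two (Nat.ceil_lt_add_one (by positivity)).le
    _ = 2 * 2 ^ (2 * t) := by rw [Real.rpow_add two_pos, Real.rpow_one, mul_comm]

lemma two_pow_levelCount_le (hη : 0 ≤ η) (h0 : 0 < ε) (h1 : ε < 1) :
    (2 : ℝ) ^ levelCount η ε ≤ 2 * ε⁻¹ ^ 2 := by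
  have ht := two_rpow_abs_log_div_log_two h0 h1
  rw [levelCount]
  set t := |Real.log ε| / Real.log 2
  have ht0 : 0 ≤ t := div_nonneg (abs_nonneg _) (Real.log_nonneg one_le_two)
  have e : ε⁻¹ ^ 2 = (2 : ℝ) ^ (2 * t) := by
    rw [← ht, ← Real.rpow_two, ← Real.rpow_mul zero_le_two, mul_comm]
  have h2 : 2 / (1 + η) ≤ 2 := div_le_self zero_le_two (by linarith)
  rw [e, ← Real.rpow_natCast]
  calc (2 : ℝ) ^ ((⌈2 / (1 + η) * t⌉₊ : ℕ) : ℝ) ≤ 2 ^ (2 * t + 1) := by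
        refine Real.rpow_le_rpow_of_exponent_le one_le_two
          ((Nat.ceil_lt_add_one (by positivity)).le.trans ?_)
        gcongr
    _ = 2 * 2 ^ (2 * t) := by rw [Real.rpow_add two_pos, Real.rpow_one, mul_comm]

lemma two_pow_levelCount_rpow_le (hη : 0 ≤ η) (h0 : 0 < ε) (h1 : ε < 1) :
    ((2 : ℝ) ^ levelCount η ε) ^ (-((1 + η) / 2)) ≤ ε := by
  have ht := two_rpow_abs_log_div_log_two h0 h1
  rw [levelCount]
  set t := |Real.log ε| / Real.log 2
  rw [← Real.rpow_natCast, ← Real.rpow_mul zero_le_two]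
  calc (2 : ℝ) ^ (((⌈2 / (1 + η) * t⌉₊ : ℕ) : ℝ) * -((1 + η) / 2)) ≤ 2 ^ (-t) := by
        refine Real.rpow_le_rpow_of_exponent_le one_le_two ?_
        have h := mul_le_mul_of_nonneg_right (Nat.le_ceil (2 / (1 + η) * t))
          (by linarith : 0 ≤ (1 + η) / 2)
        have e : 2 / (1 + η) * t * ((1 + η) / 2) = t := by field_simp
        rw [e] at h
        linarith
    _ = ε := by rw [Real.rpow_neg zero_le_two, ht, inv_inv]

lemma outerCount_pos (η ε : ℝ) (l : ℕ) : 0 < outerCount η ε l := by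
  rw [outerCount, Nat.ceil_pos]
  have : (0 : ℝ) < baseCount ε := by rw [baseCount]; positivity
  positivity

lemma innerCount_succ (K₀ l : ℕ) : innerCount K₀ (l + 1) = 2 * innerCount K₀ l := by
  simp only [innerCount, pow_succ]; ring

lemma two_pow_le_innerCount {K₀ : ℕ} (hK₀ : 1 ≤ K₀) (l : ℕ) :
    (2 : ℝ) ^ l ≤ (innerCount K₀ l : ℝ) := by
  have h : 2 ^ l ≤ innerCount K₀ l := Nat.le_mul_of_pos_left _ hK₀
  exact_mod_cast h

lemma sum_pow_le_inv {θ : ℝ} (h0 : 0 ≤ θ) (h1 : θ < 1) (n : ℕ) :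
    ∑ l ∈ Finset.range n, θ ^ l ≤ (1 - θ)⁻¹ := by
  rw [← tsum_geometric_of_lt_one h0 h1]
  exact (summable_geometric_of_lt_one h0 h1).sum_le_tsum _ fun _ _ => pow_nonneg h0 _

lemma two_rpow_neg_lt_one (hη : 0 < η) : (2 : ℝ) ^ (-(η / 4)) < 1 :=
  Real.rpow_lt_one_of_one_lt_of_neg one_lt_two (by linarith)

/-- The exponent `1 + η / 4` exceeds `1`, so the cost of the levels decays geometrically, up to the
rounding of the number of outer samples, which costs `∑ K_l = O(2 ^ L)`. -/
lemma cost_le (hη : 0 < η) (K₀ : ℕ) (h0 : 0 < ε) (h1 : ε < 1) :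
    (cost (levelCount η ε) (outerCount η ε) (innerCount K₀) : ℝ) ≤
      K₀ * (2 * (1 - (2 : ℝ) ^ (-(η / 4)))⁻¹ + 4) * ε⁻¹ ^ 2 := by
  set θ := (2 : ℝ) ^ (-(η / 4)) with hθ
  have hθ0 : 0 ≤ θ := by positivity
  have hθ1 : θ < 1 := two_rpow_neg_lt_one hη
  have hterm : ∀ l : ℕ, (outerCount η ε l : ℝ) * innerCount K₀ l ≤
      K₀ * (baseCount ε * θ ^ l + 2 ^ l) := by
    intro l
    have hc : (outerCount η ε l : ℝ) ≤ baseCount ε * (2 : ℝ) ^ (-((1 + η / 4) * l)) + 1 :=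
      (Nat.ceil_lt_add_one (by positivity)).le
    have e : (2 : ℝ) ^ (-((1 + η / 4) * l)) * 2 ^ l = θ ^ l := by
      rw [hθ, ← Real.rpow_natCast, ← Real.rpow_natCast, ← Real.rpow_mul zero_le_two,
        ← Real.rpow_add two_pos]
      congr 1; ring
    have hk : (innerCount K₀ l : ℝ) = K₀ * 2 ^ l := by simp [innerCount]
    rw [hk]
    calc (outerCount η ε l : ℝ) * (K₀ * 2 ^ l)
        ≤ (baseCount ε * (2 : ℝ) ^ (-((1 + η / 4) * l)) + 1) * (K₀ * 2 ^ l) := by gcongr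
      _ = K₀ * (baseCount ε * ((2 : ℝ) ^ (-((1 + η / 4) * l)) * 2 ^ l) + 2 ^ l) := by ring
      _ = _ := by rw [e]
  have hgeom : ∑ l ∈ Finset.range (levelCount η ε + 1), (2 : ℝ) ^ l ≤ 2 * 2 ^ levelCount η ε := by
    rw [geom_sum_eq (by norm_num)]
    norm_num [pow_succ]
    linarith
  have hL := two_pow_levelCount_le hη.le h0 h1
  have hb := (baseCount_bounds h0 h1).2
  have hs := sum_pow_le_inv hθ0 hθ1 (levelCount η ε + 1)
  have hinv : 0 ≤ (1 - θ)⁻¹ := inv_nonneg.2 (by linarith)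
  rw [cost]
  push_cast
  calc ∑ l ∈ Finset.range (levelCount η ε + 1), (outerCount η ε l : ℝ) * innerCount K₀ l
      ≤ ∑ l ∈ Finset.range (levelCount η ε + 1), K₀ * (baseCount ε * θ ^ l + 2 ^ l) :=
        Finset.sum_le_sum fun l _ => hterm l
    _ = K₀ * (baseCount ε * ∑ l ∈ Finset.range (levelCount η ε + 1), θ ^ l +
          ∑ l ∈ Finset.range (levelCount η ε + 1), (2 : ℝ) ^ l) := by
        rw [← Finset.mul_sum, Finset.sum_add_distrib, ← Finset.mul_sum]
    _ ≤ K₀ * ((2 * ε⁻¹ ^ 2) * (1 - θ)⁻¹ + 2 * (2 * ε⁻¹ ^ 2)) := by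
        gcongr
        exact hgeom.trans (by linarith)
    _ = _ := by ring

/-- The variance of one copy of the level `l + 1` correction decays faster than the number of outer
samples, by a factor `2 ^ (-η / 4)` per level. -/
lemma innerCount_rpow_div_outerCount_le (hη : 0 < η) (hη' : η ≤ 1) {K₀ : ℕ} (hK₀ : 1 ≤ K₀)
    (h0 : 0 < ε) (h1 : ε < 1) (l : ℕ) :
    (innerCount K₀ l : ℝ) ^ (-((2 + η) / 2)) / outerCount η ε (l + 1) ≤
      4 * ε ^ 2 * ((2 : ℝ) ^ (-(η / 4))) ^ l := by
  have hnum : (innerCount K₀ l : ℝ) ^ (-((2 + η) / 2)) ≤ (2 : ℝ) ^ (-(l * ((2 + η) / 2))) := by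
    calc (innerCount K₀ l : ℝ) ^ (-((2 + η) / 2)) ≤ ((2 : ℝ) ^ l) ^ (-((2 + η) / 2)) :=
          Real.rpow_le_rpow_of_nonpos (by positivity) (two_pow_le_innerCount hK₀ l) (by linarith)
      _ = _ := by
          rw [← Real.rpow_natCast, ← Real.rpow_mul zero_le_two]
          congr 1; ring
  have hden : (ε ^ 2)⁻¹ * (2 : ℝ) ^ (-((1 + η / 4) * (l + 1))) ≤ outerCount η ε (l + 1) := by
    have h2 := (baseCount_bounds h0 h1).1
    rw [inv_pow] at h2
    have h3 := Nat.le_ceil ((baseCount ε : ℝ) * (2 : ℝ) ^ (-((1 + η / 4) * ((l + 1 : ℕ) : ℝ))))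
    refine le_trans ?_ h3
    push_cast
    gcongr
  have hpos : 0 < (ε ^ 2)⁻¹ * (2 : ℝ) ^ (-((1 + η / 4) * (l + 1))) := by positivity
  calc (innerCount K₀ l : ℝ) ^ (-((2 + η) / 2)) / outerCount η ε (l + 1)
      ≤ (2 : ℝ) ^ (-(l * ((2 + η) / 2))) / ((ε ^ 2)⁻¹ * (2 : ℝ) ^ (-((1 + η / 4) * (l + 1)))) := by
        gcongr
    _ = ε ^ 2 * ((2 : ℝ) ^ (1 + η / 4) * ((2 : ℝ) ^ (-(η / 4))) ^ l) := by
        rw [← Real.rpow_natCast ((2 : ℝ) ^ (-(η / 4))), ← Real.rpow_mul zero_le_two,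
          ← Real.rpow_add two_pos, Real.rpow_neg zero_le_two ((1 + η / 4) * (l + 1))]
        have e : (2 : ℝ) ^ (1 + η / 4 + -(η / 4) * l) =
            (2 : ℝ) ^ (-(l * ((2 + η) / 2))) * (2 : ℝ) ^ ((1 + η / 4) * (l + 1)) := by
          rw [← Real.rpow_add two_pos]; congr 1; ring
        rw [e]
        field_simp
    _ ≤ ε ^ 2 * (4 * ((2 : ℝ) ^ (-(η / 4))) ^ l) := by
        gcongr
        calc (2 : ℝ) ^ (1 + η / 4) ≤ 2 ^ (2 : ℝ) :=
              Real.rpow_le_rpow_of_exponent_le one_le_two (by linarith)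
          _ = 4 := by norm_num
    _ = _ := by ring

end Parameters

/-! ### Complexity of the estimator -/

section Complexity

variable {G : Type*} [MeasurableSpace G] {P : ℕ} {ρ : Measure G} [IsProbabilityMeasure ρ]
  {κ : Kernel G (Fin P → ℝ)} [IsMarkovKernel κ] {φ : G → ℝ}

/-- With moments of order two at level `0`, second moments of order `K_{l-1} ^ (-(2 + η) / 2)` at
the levels `l ≥ 1`, and means that telescope to a bias of order `K_L ^ (-(1 + η) / 2)`, the mean
square error is of order `ε ^ 2`. -/
lemma exists_integral_sq_error_le (hφ : Measurable φ) {η : ℝ} (hη : 0 < η) (hη' : η ≤ 1) {K₀ : ℕ}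
    (hK₀ : 1 ≤ K₀) {c B V : ℝ} (hB : 0 ≤ B) (hV : 0 ≤ V)
    (hF : ∀ l, MemLp (levelFun φ (innerCount K₀) l) 2 (pathLaw ρ κ))
    (hvar : ∀ l, ∫ p, levelFun φ (innerCount K₀) (l + 1) p ^ 2 ∂(pathLaw ρ κ) ≤
      V * (innerCount K₀ l : ℝ) ^ (-((2 + η) / 2)))
    (hbias : ∀ L, |∑ l ∈ Finset.range (L + 1),
        ∫ p, levelFun φ (innerCount K₀) l p ∂(pathLaw ρ κ) - c| ≤
      B * (innerCount K₀ L : ℝ) ^ (-((1 + η) / 2))) :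
    ∃ C : ℝ, 0 < C ∧ ∀ ε : ℝ, 0 < ε → ε < 1 →
      ∀ {Ω' : Type*} [MeasurableSpace Ω'] (ν : Measure Ω') [IsProbabilityMeasure ν]
        (Xs : ℕ → ℕ → Ω' → G) (Ys : ℕ → ℕ → ℕ → Ω' → Fin P → ℝ),
        IsNestedSample ρ κ (levelCount η ε) (outerCount η ε) (innerCount K₀) ν Xs Ys →
        Integrable (fun ω => (antitheticEstimator φ (levelCount η ε) (outerCount η ε)
            (innerCount K₀) Xs Ys ω - c) ^ 2) ν ∧
        ∫ ω, (antitheticEstimator φ (levelCount η ε) (outerCount η ε)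
            (innerCount K₀) Xs Ys ω - c) ^ 2 ∂ν ≤ C * ε ^ 2 := by
  set θ := (2 : ℝ) ^ (-(η / 4))
  have hθ0 : 0 ≤ θ := by positivity
  have hθ1 : θ < 1 := two_rpow_neg_lt_one hη
  have hinv : 0 ≤ (1 - θ)⁻¹ := inv_nonneg.2 (by linarith)
  set v₀ := ∫ p, levelFun φ (innerCount K₀) 0 p ^ 2 ∂(pathLaw ρ κ)
  have hv₀0 : 0 ≤ v₀ := integral_nonneg fun _ => sq_nonneg _
  refine ⟨1 + v₀ + 4 * V * (1 - θ)⁻¹ + B ^ 2, by positivity, ?_⟩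
  intro ε h0 h1 Ω' _ ν _ Xs Ys hs
  obtain ⟨hi, hle⟩ := hs.integral_sq_error_le hφ (outerCount_pos η ε) (innerCount_succ K₀) hF c
  refine ⟨hi, hle.trans ?_⟩
  have hε2 : 0 < ε ^ 2 := by positivity
  have hzero : v₀ / outerCount η ε 0 ≤ v₀ * ε ^ 2 := by
    have hJ : (ε ^ 2)⁻¹ ≤ (outerCount η ε 0 : ℝ) := by
      have h := (baseCount_bounds h0 h1).1
      rw [inv_pow] at h
      simpa [outerCount] using h
    rw [div_eq_mul_inv]
    gcongr
    exact inv_le_of_inv_le₀ hε2 hJ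
  have hlevels : ∑ l ∈ Finset.range (levelCount η ε),
      (∫ p, levelFun φ (innerCount K₀) (l + 1) p ^ 2 ∂(pathLaw ρ κ)) / outerCount η ε (l + 1) ≤
      4 * V * (1 - θ)⁻¹ * ε ^ 2 := by
    calc ∑ l ∈ Finset.range (levelCount η ε),
          (∫ p, levelFun φ (innerCount K₀) (l + 1) p ^ 2 ∂(pathLaw ρ κ)) / outerCount η ε (l + 1)
        ≤ ∑ l ∈ Finset.range (levelCount η ε), V * (4 * ε ^ 2 * θ ^ l) := by
          refine Finset.sum_le_sum fun l _ => ?_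
          calc (∫ p, levelFun φ (innerCount K₀) (l + 1) p ^ 2 ∂(pathLaw ρ κ)) /
                outerCount η ε (l + 1)
              ≤ V * (innerCount K₀ l : ℝ) ^ (-((2 + η) / 2)) / outerCount η ε (l + 1) := by
                gcongr
                exact hvar l
            _ = V * ((innerCount K₀ l : ℝ) ^ (-((2 + η) / 2)) / outerCount η ε (l + 1)) :=
                mul_div_assoc _ _ _
            _ ≤ V * (4 * ε ^ 2 * θ ^ l) := by
                gcongr
                exact innerCount_rpow_div_outerCount_le hη hη' hK₀ h0 h1 l
      _ = 4 * V * ε ^ 2 * ∑ l ∈ Finset.range (levelCount η ε), θ ^ l := by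
          rw [Finset.mul_sum]
          exact Finset.sum_congr rfl fun l _ => by ring
      _ ≤ 4 * V * ε ^ 2 * (1 - θ)⁻¹ := by
          gcongr
          exact sum_pow_le_inv hθ0 hθ1 _
      _ = _ := by ring
  have hb : (∑ l ∈ Finset.range (levelCount η ε + 1),
      ∫ p, levelFun φ (innerCount K₀) l p ∂(pathLaw ρ κ) - c) ^ 2 ≤ B ^ 2 * ε ^ 2 := by
    rw [← mul_pow, ← sq_abs]
    refine pow_le_pow_left₀ (abs_nonneg _) ((hbias _).trans ?_) 2
    gcongr
    calc (innerCount K₀ (levelCount η ε) : ℝ) ^ (-((1 + η) / 2))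
        ≤ ((2 : ℝ) ^ levelCount η ε) ^ (-((1 + η) / 2)) :=
          Real.rpow_le_rpow_of_nonpos (by positivity) (two_pow_le_innerCount hK₀ _) (by linarith)
      _ ≤ ε := two_pow_levelCount_rpow_le hη.le h0 h1
  rw [Finset.sum_range_succ']
  nlinarith

lemma memLp_antitheticDiff_mul (hP : 0 < P) (hφ : Measurable φ)
    (h2 : ∀ᵐ x ∂ρ, ∀ q, MemLp (fun z => z q) 2 (κ x))
    (hgap : ∀ᵐ x ∂ρ, ∀ s : Fin P, 0 < s.val → runMax (meanVec (κ x)) s.val ≠ meanVec (κ x) s)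
    {η : ℝ} (hη : 0 < η) (hη' : η ≤ 1) {H : ℝ≥0∞} (hH : H < ∞)
    (hD : ∫⁻ x, (∑ s : Fin P with 0 < s.val, ∑ q ∈ Finset.Iic s,
          (∫⁻ z, ENNReal.ofReal (|z q - meanVec (κ x) q| ^ (2 + η)) ∂(κ x)) /
            ENNReal.ofReal (|meanVec (κ x) s - runMax (meanVec (κ x)) s.val| ^ η)) *
          ENNReal.ofReal (φ x ^ 2) ∂ρ ≤ H) {n : ℕ} (hn : 0 < n) :
    MemLp (fun p : G × (ℕ → Fin P → ℝ) => antitheticDiff n p.2 * φ p.1) 2 (pathLaw ρ κ) ∧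
      ∫ p, (antitheticDiff n p.2 * φ p.1) ^ 2 ∂(pathLaw ρ κ) ≤
        528 * H.toReal * (n : ℝ) ^ (-((2 + η) / 2)) := by
  have hle := (lintegral_sq_antitheticDiff_mul_le hP hφ h2 hgap hη hη' hn).trans
    (mul_le_mul' le_rfl hD)
  have htop : ENNReal.ofReal (528 * (n : ℝ) ^ (-((2 + η) / 2))) * H < ∞ :=
    ENNReal.mul_lt_top ENNReal.ofReal_lt_top hH
  have hmem : MemLp (fun p : G × (ℕ → Fin P → ℝ) => antitheticDiff n p.2 * φ p.1) 2
      (pathLaw ρ κ) := memLp_two_of_lintegral_lt_top (by fun_prop) (hle.trans_lt htop)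
  refine ⟨hmem, ?_⟩
  rw [integral_eq_lintegral_of_nonneg_ae (Filter.Eventually.of_forall fun _ => sq_nonneg _)
    hmem.integrable_sq.1]
  refine (ENNReal.toReal_mono htop.ne hle).trans (le_of_eq ?_)
  rw [ENNReal.toReal_mul, ENNReal.toReal_ofReal (by positivity)]
  ring

/-- The means of the corrections telescope to the mean of the empirical maximum over the inner
samples of the finest level. -/
lemma sum_integral_levelFun (hP : 0 < P)
    (h2 : ∀ᵐ x ∂ρ, ∀ q, MemLp (fun z => z q) 2 (κ x)) {K : ℕ → ℕ}
    (hK : ∀ l, K (l + 1) = 2 * K l) (hF : ∀ l, Integrable (levelFun φ K l) (pathLaw ρ κ))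
    (hB : ∀ l, Integrable (fun p : G × (ℕ → Fin P → ℝ) => blockMax p.2 0 (K l) * φ p.1)
      (pathLaw ρ κ)) (L : ℕ) :
    ∑ l ∈ Finset.range (L + 1), ∫ p, levelFun φ K l p ∂(pathLaw ρ κ) =
      ∫ p, blockMax p.2 0 (K L) * φ p.1 ∂(pathLaw ρ κ) := by
  induction L with
  | zero => simp [levelFun]
  | succ L ih =>
    have h := integral_antitheticDiff_mul (φ := φ) hP h2 (hF (L + 1)) (hB L)
      (hK L ▸ hB (L + 1))
    rw [Finset.sum_range_succ, ih, hK L]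
    simp only [levelFun, h]
    ring

end Complexity

end AntitheticMLMC

theorem mainTheorem3 {Ω G : Type*} [MeasurableSpace Ω] [MeasurableSpace G]
    (μ : Measure Ω) [IsProbabilityMeasure μ]
    (P : ℕ) (hP : 2 ≤ P) (η : ℝ) (hη : 0 < η) (hη' : η ≤ 1) (K₀ : ℕ) (hK₀ : 1 ≤ K₀)
    (X : Ω → G) (hX : Measurable X)
    (Y : Ω → Fin P → ℝ) (hY : Measurable Y) (hY2 : MemLp Y 2 μ)
    (φ : G → ℝ) (hφ : Measurable φ) (hφ2 : MemLp (fun ω => φ (X ω)) 2 μ)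
    -- the events `M_X^{p-1} = E_X^p`, `p = 2, …, P`, are null
    (hgap : ∀ p : Fin P, 0 < p.val →
      μ {ω | AntitheticMLMC.condMax μ X Y p.val ω = AntitheticMLMC.condMean μ X Y ω p} = 0)
    -- `E[Σ_P²(X) φ²(X)] < ∞`
    (hSigma : Integrable
      (fun ω => AntitheticMLMC.condStdSum μ X Y 2 ω * φ (X ω) ^ 2) μ)
    -- `E[C_P(X) |φ(X)|] < ∞`
    (hC : Integrable (fun ω => AntitheticMLMC.biasWeight μ X Y η ω * |φ (X ω)|) μ)
    -- `Var(M_X^P φ(X)) < ∞`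
    (hV : evariance (fun ω => AntitheticMLMC.condMax μ X Y P ω * φ (X ω)) μ < ∞)
    -- `E[D_{2+η}^q(X) φ²(X) / |E_X^p - M_X^{p-1}|^η] < ∞` for `p = 2, …, P` and `q ≤ p`
    (hD : ∀ p : Fin P, 0 < p.val → ∀ q : Fin P, q ≤ p →
      ∫⁻ ω, AntitheticMLMC.condCentralMoment μ X Y (2 + η) q ω /
          ENNReal.ofReal (AntitheticMLMC.gap μ X Y p ω ^ η) *
        ENNReal.ofReal (φ (X ω) ^ 2) ∂μ < ∞) :
    ∃ C : ℝ, 0 < C ∧ ∃ ε₀ : ℝ, 0 < ε₀ ∧ ∀ ε : ℝ, 0 < ε → ε < ε₀ →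
      (AntitheticMLMC.baseCount ε : ℝ) ≤ C * ε⁻¹ ^ 2 ∧
      (AntitheticMLMC.cost (AntitheticMLMC.levelCount η ε) (AntitheticMLMC.outerCount η ε)
        (AntitheticMLMC.innerCount K₀) : ℝ) ≤ C * ε⁻¹ ^ 2 ∧
      ∀ {Ω' : Type*} [MeasurableSpace Ω'] (ν : Measure Ω') [IsProbabilityMeasure ν]
        (Xs : ℕ → ℕ → Ω' → G) (Ys : ℕ → ℕ → ℕ → Ω' → Fin P → ℝ),
        AntitheticMLMC.IsNestedSample (μ.map X) (condDistrib Y X μ)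
          (AntitheticMLMC.levelCount η ε) (AntitheticMLMC.outerCount η ε)
          (AntitheticMLMC.innerCount K₀) ν Xs Ys →
        Integrable (fun ω => (AntitheticMLMC.antitheticEstimator φ
            (AntitheticMLMC.levelCount η ε) (AntitheticMLMC.outerCount η ε)
            (AntitheticMLMC.innerCount K₀) Xs Ys ω - AntitheticMLMC.target μ X Y φ) ^ 2) ν ∧
        ∫ ω, (AntitheticMLMC.antitheticEstimator φ
            (AntitheticMLMC.levelCount η ε) (AntitheticMLMC.outerCount η ε)
            (AntitheticMLMC.innerCount K₀) Xs Ys ω - AntitheticMLMC.target μ X Y φ) ^ 2 ∂ν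
          ≤ C * ε ^ 2 := by
  have hP0 : 0 < P := by omega
  have hρ : IsProbabilityMeasure (μ.map X) := Measure.isProbabilityMeasure_map hX.aemeasurable
  have h2 := AntitheticMLMC.ae_memLp_condDistrib hX hY hY2
  have hgap' := AntitheticMLMC.ae_runMax_ne_meanVec hX hY hY2 hgap
  have hS := AntitheticMLMC.integrable_variance_mul hX hY hY2 hφ hSigma
  have hC' := AntitheticMLMC.integrable_biasWeight_mul hX hY hY2 hφ hC
  have hM := AntitheticMLMC.memLp_runMax_mul hX hY hY2 hφ hV
  have hD' := AntitheticMLMC.lintegral_centralMoment_mul_lt_top hX hY hY2 hφ hD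
  have hKpos : ∀ l, 0 < AntitheticMLMC.innerCount K₀ l := fun l =>
    Nat.mul_pos hK₀ (Nat.two_pow_pos l)
  have hblock := fun l => AntitheticMLMC.memLp_blockMax_mul hP0 hφ h2 hS hM (hKpos l)
  have hanti := fun l =>
    AntitheticMLMC.memLp_antitheticDiff_mul hP0 hφ h2 hgap' hη hη' hD' le_rfl (hKpos l)
  have hF : ∀ l, MemLp (AntitheticMLMC.levelFun φ (AntitheticMLMC.innerCount K₀) l) 2
      (AntitheticMLMC.pathLaw (μ.map X) (condDistrib Y X μ)) := fun l => by
    cases l with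
    | zero => exact hblock 0
    | succ l => exact (hanti l).1
  have hnn : ∀ x, 0 ≤ (2 ^ η * (∑ q, √(Var[fun z => z q; condDistrib Y X μ x]) ^ (1 + η)) *
      ∑ s : Fin P with 0 < s.val, 1 / |AntitheticMLMC.meanVec (condDistrib Y X μ x) s -
        AntitheticMLMC.runMax (AntitheticMLMC.meanVec (condDistrib Y X μ x)) s.val| ^ η) * |φ x| :=
    fun x => by positivity
  obtain ⟨C, hC0, hCε⟩ := AntitheticMLMC.exists_integral_sq_error_le hφ hη hη' hK₀
    (c := AntitheticMLMC.target μ X Y φ) (mul_nonneg zero_le_two (integral_nonneg hnn))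
    (mul_nonneg (by norm_num : (0 : ℝ) ≤ 528) ENNReal.toReal_nonneg) hF (fun l => (hanti l).2)
    (fun L => by
      rw [AntitheticMLMC.sum_integral_levelFun hP0 h2 (AntitheticMLMC.innerCount_succ K₀)
        (fun l => (hF l).integrable one_le_two) (fun l => (hblock l).integrable one_le_two),
        AntitheticMLMC.target_eq hX hY hY2 hφ, mul_right_comm]
      exact AntitheticMLMC.abs_integral_blockMax_mul_sub_le hP0 h2 hgap' hη hη' hC'
        (hM.integrable one_le_two) (hKpos L) ((hblock L).integrable one_le_two))
  have hθ : 0 ≤ (1 - (2 : ℝ) ^ (-(η / 4)))⁻¹ :=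
    inv_nonneg.2 (sub_nonneg.2 (AntitheticMLMC.two_rpow_neg_lt_one hη).le)
  set c₁ := (K₀ : ℝ) * (2 * (1 - (2 : ℝ) ^ (-(η / 4)))⁻¹ + 4)
  have hc₁0 : 0 ≤ c₁ := by positivity
  refine ⟨2 + c₁ + C, by positivity, 1, one_pos, fun ε h0 h1 => ⟨?_, ?_, ?_⟩⟩
  · refine (AntitheticMLMC.baseCount_bounds h0 h1).2.trans ?_
    gcongr
    linarith
  · refine (AntitheticMLMC.cost_le hη K₀ h0 h1).trans ?_
    gcongr
    linarith
  · intro Ω' _ ν _ Xs Ys hs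
    obtain ⟨hi, hle⟩ := hCε ε h0 h1 ν Xs Ys hs
    refine ⟨hi, hle.trans ?_⟩
    gcongr
    linarith
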